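/- **Setting.** Let $t,\ell\ge 0$ be integers, let $\mathbf x$ and $\mathbf y$ be disjoint sets of indeterminates, and let $a^{(i)}_k\in\mathbb R[\mathbf x]$ $(0\le i\le \ell,\ k\ge 0)$ and $b_k\in\mathbb R[\mathbf y]$ $(k\ge 0)$ be polynomials with nonnegative coefficients. Let $T=[T_{n,k}]_{n,k\ge0}$ be the matrix over $\mathbb R[\mathbf x,\mathbf y]$ with $T_{0,0}=1$, $T_{n,k}=0$ if $n<0$ or $k<0$, and, for $(n,k)\ne(0,0)$ in $\mathbb N^2$, $$T_{n,k}=\sum_{i=0}^{\ell}a^{(i)}_k\,T_{n-1,k-t-i}+b_k\,T_{n,k-1}.$$ (So $T_{0,k}=b_1b_2\cdots b_k$; $T_{n,0}=(a_0^{(0)})^n$ if $t=0$; and $T_{n,k}=0$ if $n\ge1$ and $0\le k\le t-1$.) Let $\mathcal A=[\mathcal A_{i,j}]_{i,j\ge0}$ be given by $\mathcal A_{i,j}=a_i^{(i-j)}$ for $i-\ell\le j\le i$ and $\mathcal A_{i,j}=0$ otherwise. A matrix of real polynomials in a set $\mathbf u$ of indeterminates is *$\mathbf u$-totally positive (of order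 $r$)* if all its minors (all its minors of order at most $r$) have nonnegative coefficients. The Toeplitz matrix of a sequence $(s_i)_{i\ge0}$ is $[s_{i-j}]_{i,j\ge0}$ with $s_m=0$ for $m<0$. **Theorem.** **(A)** For every $r\ge 0$, if $\mathcal A$ is $\mathbf x$-totally positive of order $r$, then $T$ is $(\mathbf x,\mathbf y)$-totally positive of order $r$. If $\mathcal A$ is $\mathbf x$-totally positive, then $T$ is $(\mathbf x,\mathbf y)$-totally positive. **(B)** If $\ell=1$, then $T$ is $(\mathbf x,\mathbf y)$-totally positive, and if moreover $t\ge1$, then the Toeplitz matrix of each column sequence $(T_{n,k})_{n\ge0}$ is $(\mathbf x,\mathbf y)$-totally positive. **(C)** If $\ell=2$ and there are sequences $(\alpha_k),(\beta_k),(\lambda_k),(\mu_k)$ $(k\ge0)$ of polynomials in $\mathbb R[\mathbf x]$ with nonnegative coefficients such that $a_k^{(0)}=\alpha_k\lambda_k$ for $k\ge0$, $a_k^{(1)}=\alpha_k\mu_k+\beta_k\lambda_{k-1}$ for $k\ge1$, and $a_k^{(2)}=\beta_k\mu_{k-1}$ for $k\ge2$, then both conclusions of (B) hold. **(D)** Suppose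 that $\mathbf x=(\boldsymbol\alpha,\boldsymbol\beta)$ with indeterminates $\boldsymbol\alpha=(\alpha_j)_{j=1}^{\ell}$, $\boldsymbol\beta=(\beta_j)_{j=1}^{\ell}$, and that $\sum_{i=0}^{\ell}a_k^{(i)}z^i=\prod_{j=1}^{\ell}(\alpha_jz+\beta_j)$ for all $k\ge0$. Then: (i) $T$ is $(\boldsymbol\alpha,\boldsymbol\beta,\mathbf y)$-totally positive, and if $t\ge1$, then so is the Toeplitz matrix of each column sequence $(T_{n,k})_{n\ge0}$. Suppose in addition that $b_k=\gamma$ for all $k\ge0$, where $\gamma\in\mathbb R[\mathbf y]$ has nonnegative coefficients (for instance, $\gamma$ is an indeterminate and $\mathbf y=\{\gamma\}$). Then: (ii) the Toeplitz matrix of each row sequence $(T_{n,k})_{k\ge0}$ is $(\boldsymbol\alpha,\boldsymbol\beta,\mathbf y)$-totally positive; (iii) if $t\ge1$, $0\le n\le k$, $0<\delta$ and $\max\{n,\delta\}<\sigma$, then the Toeplitz matrix of the sequence $(T_{n+\sigma i,k+\delta i})_{i\ge0}$ is $(\boldsymbol\alpha,\boldsymbol\beta,\mathbf y)$-totally positive;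 (iv) for all $n,k\ge0$, $$T_{n,k}=\sum_{\substack{i\ge0,\ 0\le c_1,\dots,c_\ell\le n\\ i+c_1+\cdots+c_\ell=k-tn}}\binom{n+i}{i}\gamma^i\prod_{j=1}^{\ell}\binom{n}{c_j}\alpha_j^{c_j}\beta_j^{n-c_j};$$ (v) as formal power series in $q,z$, writing $a^{(i)}$ for the common value of $a^{(i)}_k$ $(k\ge0)$, $$\sum_{n,k\ge0}T_{n,k}q^nz^k=\frac{1}{1-\gamma z-q\sum_{i=0}^{\ell}a^{(i)}z^{t+i}}.$$ -/

import Mathlib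

namespace LatticeTP

/-- A real polynomial all of whose coefficients are nonnegative. -/
def CoeffNonneg {τ : Type*} (p : MvPolynomial τ ℝ) : Prop :=
  ∀ m : τ →₀ ℕ, 0 ≤ p.coeff m

/-- `x`-total positivity of order `r` of an infinite matrix over `ℝ[x]`: every minor of order
`m ≤ r` (rows `f 0 < ⋯ < f (m-1)`, columns `g 0 < ⋯ < g (m-1)`) is a polynomial with
nonnegative coefficients. -/
def TotallyPositiveOfOrder {τ : Type*} (r : ℕ) (A : Matrix ℕ ℕ (MvPolynomial τ ℝ)) : Prop :=
  ∀ m : ℕ, m ≤ r → ∀ f g : Fin m → ℕ, StrictMono f → StrictMono g →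
    CoeffNonneg (A.submatrix f g).det

/-- `x`-total positivity of an infinite matrix over `ℝ[x]`: every minor is a polynomial with
nonnegative coefficients. -/
def TotallyPositive {τ : Type*} (A : Matrix ℕ ℕ (MvPolynomial τ ℝ)) : Prop :=
  ∀ (m : ℕ) (f g : Fin m → ℕ), StrictMono f → StrictMono g →
    CoeffNonneg (A.submatrix f g).det

/-- The Toeplitz matrix `[s_{i-j}]_{i,j ≥ 0}` of a sequence `(s_k)_{k ≥ 0}`, where `s_k = 0` for
`k < 0`. -/
def toeplitz {R : Type*} [Zero R] (s : ℕ → R) : Matrix ℕ ℕ R :=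
  fun i j => if j ≤ i then s (i - j) else 0

/-- The `ℓ`-banded lower triangular matrix with entries `a_i^{(i-j)}` for `i - ℓ ≤ j ≤ i` and
`0` elsewhere; here `a i n` stands for `a_n^{(i)}`. -/
def bandMatrix {R : Type*} [Zero R] (ℓ : ℕ) (a : ℕ → ℕ → R) : Matrix ℕ ℕ R :=
  fun i j => if j ≤ i ∧ i ≤ j + ℓ then a (i - j) i else 0

/-- The `k`-recursive matrix with parameters `t`, `ℓ` and weights `a i k = a_k^{(i)}`, `b k`:
`T_{0,0} = 1` and
`T_{n,k} = ∑_{i=0}^{ℓ} a_k^{(i)} T_{n-1,k-t-i} + b_k T_{n,k-1}` for `(n,k) ≠ (0,0)`,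
where entries with a negative index are `0`. -/
def recMatrix {R : Type*} [CommSemiring R] (t ℓ : ℕ) (a : ℕ → ℕ → R) (b : ℕ → R) :
    ℕ → ℕ → R
  | 0, 0 => 1
  | 0, k + 1 => b (k + 1) * recMatrix t ℓ a b 0 k
  | n + 1, 0 => ∑ i ∈ Finset.range (ℓ + 1),
      if t + i ≤ 0 then a i 0 * recMatrix t ℓ a b n 0 else 0
  | n + 1, k + 1 => (∑ i ∈ Finset.range (ℓ + 1),
      if t + i ≤ k + 1 then a i (k + 1) * recMatrix t ℓ a b n (k + 1 - (t + i)) else 0) +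
      b (k + 1) * recMatrix t ℓ a b (n + 1) k
termination_by n k => (n, k)

section RecMatrixFacts

variable {R : Type*} [CommSemiring R] (t ℓ : ℕ) (a : ℕ → ℕ → R) (b : ℕ → R)

/-- The entries extended by `0` to negative indices. -/
def recMatrixZ (n k : ℤ) : R :=
  if 0 ≤ n ∧ 0 ≤ k then recMatrix t ℓ a b n.toNat k.toNat else 0

/-- The defining recurrence relation. -/
theorem recMatrixZ_rec (n k : ℕ) (h : ¬ (n = 0 ∧ k = 0)) :
    recMatrixZ t ℓ a b n k =
      (∑ i ∈ Finset.range (ℓ + 1), a i k * recMatrixZ t ℓ a b (n - 1) (k - t - i)) +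
        b k * recMatrixZ t ℓ a b n (k - 1) := by
  have key : ∀ (n k i : ℕ), a i k * recMatrixZ t ℓ a b (((n + 1 : ℕ) : ℤ) - 1) ((k : ℤ) - t - i)
      = if t + i ≤ k then a i k * recMatrix t ℓ a b n (k - (t + i)) else 0 := by
    intro n k i
    unfold recMatrixZ
    by_cases hk : t + i ≤ k
    · have h1 : (0 : ℤ) ≤ ((n + 1 : ℕ) : ℤ) - 1 ∧ (0 : ℤ) ≤ (k : ℤ) - t - i := by omega
      have h2 : (((n + 1 : ℕ) : ℤ) - 1).toNat = n := by omega
      have h3 : ((k : ℤ) - t - i).toNat = k - (t + i) := by omega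
      rw [if_pos h1, if_pos hk, h2, h3]
    · have h1 : ¬ ((0 : ℤ) ≤ ((n + 1 : ℕ) : ℤ) - 1 ∧ (0 : ℤ) ≤ (k : ℤ) - t - i) := by omega
      rw [if_neg h1, if_neg hk, mul_zero]
  have e : ∀ n k : ℕ, recMatrixZ t ℓ a b n k = recMatrix t ℓ a b n k := by
    intro n k; simp [recMatrixZ]
  have e0 : ∀ k : ℤ, recMatrixZ t ℓ a b (((0 : ℕ) : ℤ) - 1) k = 0 := by
    intro k; simp [recMatrixZ]
  have e1 : ∀ n : ℤ, recMatrixZ t ℓ a b n (((0 : ℕ) : ℤ) - 1) = 0 := by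
    intro n; simp [recMatrixZ]
  have e2 : ∀ k : ℕ, (((k + 1 : ℕ) : ℤ) - 1) = (k : ℤ) := by intro k; omega
  match n, k with
  | 0, 0 => exact absurd ⟨rfl, rfl⟩ h
  | 0, k + 1 => simp only [e0, e2, e, mul_zero, Finset.sum_const_zero, zero_add]; rw [recMatrix]
  | n + 1, 0 =>
    simp only [key, e1, e, mul_zero, add_zero]
    rw [recMatrix]
    refine Finset.sum_congr rfl fun i _ => ?_
    simp
  | n + 1, k + 1 =>
    simp only [key]
    simp only [e2, e]
    rw [recMatrix]

theorem recMatrix_zero_zero : recMatrix t ℓ a b 0 0 = 1 := by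
  rw [recMatrix]

/-- The initial values in the row `n = 0`. -/
theorem recMatrix_zero_left (k : ℕ) :
    recMatrix t ℓ a b 0 k = ∏ i ∈ Finset.range k, b (k - i) := by
  induction k with
  | zero => simp [recMatrix]
  | succ k ih =>
    rw [recMatrix, ih, Finset.prod_range_succ', mul_comm]
    simp

/-- The initial values in the column `k = 0` for `t = 0`. -/
theorem recMatrix_zero_right (n : ℕ) : recMatrix 0 ℓ a b n 0 = a 0 0 ^ n := by
  induction n with
  | zero => simp [recMatrix]
  | succ n ih =>
    rw [recMatrix, ih, Finset.sum_range_succ']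
    simp [pow_succ, mul_comm]

/-- The initial values in the columns `0 ≤ k ≤ t - 1` for `n ≥ 1`. -/
theorem recMatrix_eq_zero (n k : ℕ) (hk : k < t) : recMatrix t ℓ a b (n + 1) k = 0 := by
  induction k with
  | zero =>
    rw [recMatrix]
    exact Finset.sum_eq_zero fun i _ => if_neg (by omega)
  | succ k ih =>
    rw [recMatrix, ih (by omega), mul_zero, add_zero]
    exact Finset.sum_eq_zero fun i _ => if_neg (by omega)

end RecMatrixFacts

/-- The matrix `T` over `ℝ[x, y]` (the indeterminates `x` are indexed by `I`, the indeterminates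
`y` by `J`) with weights `a i k = a_k^{(i)} ∈ ℝ[x]` and `b k ∈ ℝ[y]`. -/
noncomputable def transposeMatrix {I J : Type*} (t ℓ : ℕ) (a : ℕ → ℕ → MvPolynomial I ℝ)
    (b : ℕ → MvPolynomial J ℝ) : Matrix ℕ ℕ (MvPolynomial (I ⊕ J) ℝ) :=
  recMatrix t ℓ (fun i k => MvPolynomial.rename Sum.inl (a i k))
    (fun k => MvPolynomial.rename Sum.inr (b k))

/-- The generating function `∑_{n,k ≥ 0} T_{n,k} q^n z^k`, a formal power series in `q = X 0` and
`z = X 1`. -/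
def genFun {R : Type*} (T : Matrix ℕ ℕ R) : MvPowerSeries (Fin 2) R :=
  fun m => T (m 0) (m 1)

end LatticeTP

namespace LatticeTP

open Finset

/-! ### Minors in a subsemiring: Cauchy–Binet, bidiagonal matrices and their resolvents -/

section Minors

variable {R : Type*} [CommRing R]

/-! Polynomials with nonnegative coefficients form a subsemiring, so total positivity is the
statement `MinorsMem` that minors lie in a subsemiring `N`. By Cauchy–Binet this property survives
lower triangular products. A bidiagonal matrix with entries in `N` has it because each minor is a
single product of entries, and so does the inverse of a unit lower bidiagonal matrix with
subdiagonal `-e`, being a limit of products of bidiagonal matrices (`MinorsMem.step`).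

For (A), the recurrence says that the transpose of `T` arises from itself by multiplying with the
(column-shifted) band matrix, prepending a unit column, and applying the resolvent of `b`. Induction
on the number of rows of `T` gives `minorsMem_recMatrix`.

For Toeplitz matrices of columns, a factorization of the band matrix into bidiagonal ones turns the
passage from one row to the next into a block of elementary layers of a planar network, repeated
periodically. The network can also be read in the other direction, level by level in `k`, where the
same step lemma applies with horizontal and vertical weights exchanged. Periodicity makes a
submatrix of the resulting transfer matrix Toeplitz (`minorsMem_toeplitz_pathSum`).

For constant factorizing weights every layer multiplies the generating function by a linear or
geometric series, so row `n` has generating function `z^(tn) F^n / (1 - γz)^(n+1)` with `F = ∏ (α_j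
z + β_j)`. This gives rows as products of Pólya frequency sequences, and (iv) by binomial expansion.
As the layers commute they can be rearranged into a network for slanted sequences
(`minorsMem_toeplitz_slanted`). Finally, (v) is the recurrence read off coefficientwise. -/

theorem det_mul_eq_sum_functions {m n : ℕ} (A : Matrix (Fin m) (Fin n) R)
    (B : Matrix (Fin n) (Fin m) R) :
    (A * B).det = ∑ p : Fin m → Fin n, (∏ i, A i (p i)) * (B.submatrix p id).det := by
  have h : A * B = fun i => ∑ j, A i j • B j := by
    ext i k
    simp [Matrix.mul_apply, Finset.sum_apply]
  have h2 := (Matrix.detRowAlternating (n := Fin m) (R := R)).toMultilinearMap.map_sum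
    (fun i (j : Fin n) => A i j • B j)
  rw [h]
  refine h2.trans (Finset.sum_congr rfl fun p _ => ?_)
  exact (Matrix.detRowAlternating (n := Fin m) (R := R)).toMultilinearMap.map_smul_univ
    (fun i => A i (p i)) (fun i => B (p i))

/-- The Cauchy–Binet formula. -/
theorem det_mul_eq_sum_orderEmbedding {m n : ℕ} (A : Matrix (Fin m) (Fin n) R)
    (B : Matrix (Fin n) (Fin m) R) :
    (A * B).det =
      ∑ e : Fin m ↪o Fin n, (A.submatrix id e).det * (B.submatrix e id).det := by
  classical
  have key : ∀ e : Fin m ↪o Fin n, (A.submatrix id e).det * (B.submatrix e id).det =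
      ∑ σ : Equiv.Perm (Fin m),
        (∏ i, A i ((e ∘ σ) i)) * (B.submatrix (e ∘ σ) id).det := by
    intro e
    rw [← Matrix.det_transpose, Matrix.det_apply', Finset.sum_mul]
    refine Finset.sum_congr rfl fun σ _ => ?_
    have : B.submatrix (e ∘ σ) id = (B.submatrix e id).submatrix σ id := rfl
    rw [this, Matrix.det_permute]
    simp only [Matrix.transpose_apply, Matrix.submatrix_apply, id, Function.comp]
    ring
  rw [det_mul_eq_sum_functions, Finset.sum_congr rfl fun e _ => key e,
    ← Finset.sum_product', Finset.univ_product_univ]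
  -- A non-injective `p` repeats a row of `B`; an injective one factors uniquely as an order
  -- embedding after a permutation, the latter found by sorting.
  rw [← Finset.sum_filter_of_ne (p := fun p : Fin m → Fin n => Function.Injective p)]
  · symm
    refine Finset.sum_bij (fun x _ => x.1 ∘ x.2) ?_ ?_ ?_ ?_
    · intro x _
      simpa using x.1.injective.comp x.2.injective
    · rintro ⟨e, σ⟩ _ ⟨e', σ'⟩ _ h
      have hr : (e : Fin m → Fin n) = e' := by
        apply (e.strictMono.range_inj e'.strictMono).1
        have := congrArg Set.range h
        simpa [Set.range_comp] using this
      have he : e = e' := DFunLike.coe_injective hr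
      subst he
      have : σ = σ' := by
        ext i
        have := congrFun h i
        simpa [Fin.val_inj] using this
      rw [this]
    · intro p hp
      have hp : Function.Injective p := by simpa using hp
      have hm : StrictMono (p ∘ Tuple.sort p) :=
        (Tuple.monotone_sort p).strictMono_of_injective (hp.comp (Tuple.sort p).injective)
      refine ⟨(OrderEmbedding.ofStrictMono _ hm, (Tuple.sort p)⁻¹), Finset.mem_univ _, ?_⟩
      ext i
      simp
    · intro x _
      rfl
  · intro p _ hne
    by_contra hinj
    apply hne
    rw [Function.Injective] at hinj
    push Not at hinj
    obtain ⟨i, j, hij, hne'⟩ := hinj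
    rw [Matrix.det_zero_of_row_eq hne' (by ext k; simp [hij]), mul_zero]

/-- All minors of order at most `r` lie in the subsemiring `N`. -/
def MinorsMem (N : Subsemiring R) (r : ℕ) (A : Matrix ℕ ℕ R) : Prop :=
  ∀ m : ℕ, m ≤ r → ∀ f g : Fin m → ℕ, StrictMono f → StrictMono g →
    (A.submatrix f g).det ∈ N

variable {N : Subsemiring R} {r : ℕ}

theorem MinorsMem.submatrix {A : Matrix ℕ ℕ R} (hA : MinorsMem N r A) {f g : ℕ → ℕ}
    (hf : StrictMono f) (hg : StrictMono g) : MinorsMem N r (A.submatrix f g) :=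
  fun m hm f' g' hf' hg' => hA m hm (f ∘ f') (g ∘ g') (hf.comp hf') (hg.comp hg')

theorem MinorsMem.congr {A B : Matrix ℕ ℕ R} (hA : MinorsMem N r A)
    (h : ∀ i j, A i j = B i j) : MinorsMem N r B := by
  rwa [← Matrix.ext h]

/-- A single minor involves only finitely many rows, so the property passes to matrices approximated
on initial rows. -/
theorem MinorsMem.congr_rows {B : Matrix ℕ ℕ R}
    (h : ∀ n, ∃ C, MinorsMem N r C ∧ ∀ i ≤ n, ∀ j, C i j = B i j) : MinorsMem N r B := by
  intro m hm f g hf hg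
  obtain ⟨C, hC, hCB⟩ := h (Finset.univ.sup f)
  have : B.submatrix f g = C.submatrix f g := by
    ext i j
    exact (hCB _ (Finset.le_sup (f := f) (Finset.mem_univ i)) _).symm
  rw [this]
  exact hC m hm f g hf hg

/-- Triangularity keeps the sums finite, so the chosen rows live in a product of finite matrices cut
off at a common `n`, to which Cauchy–Binet applies. -/
theorem MinorsMem.lower_mul {A B : Matrix ℕ ℕ R} (hA : MinorsMem N r A) (hB : MinorsMem N r B)
    (hl : ∀ i k, i < k → A i k = 0) :
    MinorsMem N r (fun i j => ∑ k ∈ range (i + 1), A i k * B k j) := by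
  intro m hm f g hf hg
  let n := Finset.univ.sup f + 1
  have hn : ∀ i, f i + 1 ≤ n := fun i =>
    Nat.succ_le_succ (Finset.le_sup (f := f) (Finset.mem_univ i))
  have : Matrix.submatrix (fun i j => ∑ k ∈ range (i + 1), A i k * B k j) f g =
      A.submatrix f (Fin.val : Fin n → ℕ) * B.submatrix (Fin.val : Fin n → ℕ) g := by
    ext i j
    simp only [Matrix.submatrix_apply, Matrix.mul_apply]
    rw [Fin.sum_univ_eq_sum_range (fun k => A (f i) k * B k (g j))]
    refine Finset.sum_subset (Finset.range_subset_range.2 (hn i)) fun k _ hk => ?_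
    rw [hl _ _ (by simpa [Nat.lt_succ_iff] using hk), zero_mul]
  rw [this, det_mul_eq_sum_orderEmbedding]
  refine sum_mem fun e _ => mul_mem ?_ ?_
  · exact hA m hm f (Fin.val ∘ e) hf (Fin.val_strictMono.comp e.strictMono)
  · exact hB m hm (Fin.val ∘ e) g (Fin.val_strictMono.comp e.strictMono) hg

/-- The lower bidiagonal matrix with diagonal `d` and subdiagonal `c`. -/
def bidiagonal (d c : ℕ → R) : Matrix ℕ ℕ R :=
  fun i j => if j = i then d i else if j + 1 = i then c i else 0

/-- Only the identity permutation contributes: a nonvanishing term has `g i ≤ f (σ i) ≤ g i + 1` for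
all `i`, so `i < j` gives `f (σ i) ≤ g i + 1 ≤ g j ≤ f (σ j)`, and `σ` is increasing. -/
theorem det_bidiagonal_submatrix (d c : ℕ → R) {m : ℕ} {f g : Fin m → ℕ} (hf : StrictMono f)
    (hg : StrictMono g) :
    ((bidiagonal d c).submatrix f g).det = ∏ i, bidiagonal d c (f i) (g i) := by
  rw [Matrix.det_apply, Finset.sum_eq_single 1]
  · simp
  · intro σ _ hσ
    suffices h : ∃ i, bidiagonal d c (f (σ i)) (g i) = 0 by
      obtain ⟨i, hi⟩ := h
      rw [Finset.prod_eq_zero (Finset.mem_univ i) (by simpa using hi), smul_zero]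
    by_contra! h
    apply hσ
    have hb : ∀ i, g i = f (σ i) ∨ g i + 1 = f (σ i) := by
      intro i
      have := h i
      unfold bidiagonal at this
      by_contra! hc
      rw [if_neg hc.1, if_neg hc.2] at this
      exact this rfl
    have hs : StrictMono σ := by
      intro i j hij
      by_contra hc
      have hne : σ i ≠ σ j := fun he => hij.ne (σ.injective he)
      have h1 : f (σ j) < f (σ i) := hf (lt_of_le_of_ne (not_lt.1 hc) hne.symm)
      have h2 := hg hij
      have := hb i
      have := hb j
      omega
    have := (hs.range_inj strictMono_id).1 (by simp)
    ext i
    simp [this]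
  · simp

theorem minorsMem_bidiagonal {d c : ℕ → R} (hd : ∀ k, d k ∈ N) (hc : ∀ k, c k ∈ N) :
    MinorsMem N r (bidiagonal d c) := by
  intro m _ f g hf hg
  rw [det_bidiagonal_submatrix d c hf hg]
  refine prod_mem fun i _ => ?_
  unfold bidiagonal
  split_ifs
  exacts [hd _, hc _, zero_mem _]

/-- Application of a bidiagonal matrix to a column vector. -/
def bidiagonalStep (d c : ℕ → R) (v : ℕ → R) : ℕ → R
  | 0 => d 0 * v 0
  | k + 1 => d (k + 1) * v (k + 1) + c (k + 1) * v k

/-- The solution `u` of `u_k = v_k + e_k u_{k-1}`. -/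
def resolventStep (e : ℕ → R) (v : ℕ → R) : ℕ → R
  | 0 => v 0
  | k + 1 => v (k + 1) + e (k + 1) * resolventStep e v k

/-- The solution `u` of `u_k = d_k v_k + c_k v_{k-1} + e_k u_{k-1}`. -/
def step (d c e : ℕ → R) (v : ℕ → R) : ℕ → R :=
  resolventStep e (bidiagonalStep d c v)

theorem step_zero (d c e v : ℕ → R) : step d c e v 0 = d 0 * v 0 := rfl

theorem step_succ (d c e v : ℕ → R) (k : ℕ) : step d c e v (k + 1) =
    d (k + 1) * v (k + 1) + c (k + 1) * v k + e (k + 1) * step d c e v k := rfl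

theorem bidiagonalStep_eq_sum (d c v : ℕ → R) (k : ℕ) :
    bidiagonalStep d c v k = ∑ i ∈ range (k + 1), bidiagonal d c k i * v i := by
  cases k with
  | zero => simp [bidiagonal, bidiagonalStep]
  | succ k =>
    rw [Finset.sum_range_succ, Finset.sum_range_succ, Finset.sum_eq_zero]
    · simp [bidiagonal, bidiagonalStep, add_comm]
    · intro i hi
      have := Finset.mem_range.1 hi
      rw [bidiagonal, if_neg (by omega), if_neg (by omega), zero_mul]

theorem MinorsMem.bidiagonalStep {A : Matrix ℕ ℕ R} (hA : MinorsMem N r A) {d c : ℕ → R}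
    (hd : ∀ k, d k ∈ N) (hc : ∀ k, c k ∈ N) :
    MinorsMem N r (fun k j => bidiagonalStep d c (fun i => A i j) k) := by
  simp only [bidiagonalStep_eq_sum]
  refine (minorsMem_bidiagonal hd hc).lower_mul hA fun i k h => ?_
  rw [bidiagonal, if_neg (by omega), if_neg (by omega)]

/-- The recursion is resolved one row at a time: row `n + 1` is corrected by an elementary
bidiagonal matrix with the single off-diagonal entry `e (n + 1)`, and rows up to `n` are then final.
-/
theorem MinorsMem.resolventStep {A : Matrix ℕ ℕ R} (hA : MinorsMem N r A) {e : ℕ → R}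
    (he : ∀ k, e k ∈ N) :
    MinorsMem N r (fun k j => resolventStep e (fun i => A i j) k) := by
  have key : ∀ n, MinorsMem N r
      (fun k j => if k ≤ n then LatticeTP.resolventStep e (fun i => A i j) k else A k j) := by
    intro n
    induction n with
    | zero =>
      refine hA.congr fun k j => ?_
      split_ifs with h
      · obtain rfl : k = 0 := by omega
        rfl
      · rfl
    | succ n ih =>
      have h2 := ih.bidiagonalStep (d := 1) (c := fun k => if k = n + 1 then e k else 0)
        (fun _ => one_mem _) (fun k => by split_ifs; exacts [he _, zero_mem _])
      refine h2.congr fun k j => ?_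
      cases k with
      | zero => simp [LatticeTP.bidiagonalStep]
      | succ k =>
        rcases lt_trichotomy k n with h | rfl | h
        · simp [LatticeTP.bidiagonalStep, show k + 1 ≤ n + 1 by omega, show k + 1 ≤ n by omega,
            show k ≠ n by omega, h.le]
        · simp [LatticeTP.bidiagonalStep, LatticeTP.resolventStep]
        · simp [LatticeTP.bidiagonalStep, show ¬ k + 1 ≤ n + 1 by omega,
            show ¬ k + 1 ≤ n by omega, show k ≠ n by omega]
  refine MinorsMem.congr_rows fun n => ⟨_, key n, fun i hi j => if_pos hi⟩

theorem MinorsMem.step {A : Matrix ℕ ℕ R} (hA : MinorsMem N r A) {d c e : ℕ → R}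
    (hd : ∀ k, d k ∈ N) (hc : ∀ k, c k ∈ N) (he : ∀ k, e k ∈ N) :
    MinorsMem N r (fun k j => step d c e (fun i => A i j) k) :=
  (hA.bidiagonalStep hd hc).resolventStep he

end Minors

/-! ### Total positivity of the recursive matrix -/

section Recursive

variable {R : Type*} [CommRing R] {N : Subsemiring R} {r : ℕ}

theorem MinorsMem.transpose {A : Matrix ℕ ℕ R} (hA : MinorsMem N r A) :
    MinorsMem N r A.transpose := by
  intro m hm f g hf hg
  rw [← Matrix.transpose_submatrix, Matrix.det_transpose]
  exact hA m hm g f hg hf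

theorem minorsMem_zero : MinorsMem N r (0 : Matrix ℕ ℕ R) :=
  (minorsMem_bidiagonal (N := N) (d := 0) (c := 0) (fun _ => zero_mem _)
    (fun _ => zero_mem _)).congr fun i j => by simp [bidiagonal]

theorem minorsMem_one : MinorsMem N r (1 : Matrix ℕ ℕ R) :=
  (minorsMem_bidiagonal (N := N) (d := 1) (c := 0) (fun _ => one_mem _)
    (fun _ => zero_mem _)).congr fun i j => by simp [bidiagonal, Matrix.one_apply, eq_comm]

/-- The matrix `A` with the first unit vector inserted as a new first column. -/
def consUnit (A : Matrix ℕ ℕ R) : Matrix ℕ ℕ R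
  | k, 0 => if k = 0 then 1 else 0
  | k, j + 1 => A k j

/-- In a minor using the new column, that column is zero or has its `1` in the top left corner, so
Laplace expansion produces no sign. -/
theorem MinorsMem.consUnit {A : Matrix ℕ ℕ R} (hA : MinorsMem N r A) :
    MinorsMem N r (consUnit A) := by
  intro m hm f g hf hg
  cases m with
  | zero => rw [Matrix.det_isEmpty]; exact one_mem _
  | succ m =>
    have shift : ∀ {l : ℕ} (g' : Fin l → ℕ), (∀ i, 0 < g' i) → StrictMono g' →
        ∃ h : Fin l → ℕ, StrictMono h ∧ ∀ i, g' i = h i + 1 := by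
      intro l g' hpos hmono
      refine ⟨fun i => g' i - 1, fun i j hij => ?_, fun i => ?_⟩
      · have := hmono hij
        have := hpos i
        simp only
        omega
      · exact (Nat.sub_add_cancel (hpos i)).symm
    by_cases hg0 : g 0 = 0
    · obtain ⟨h, hh, hgh⟩ := shift (fun i => g i.succ)
        (fun i => by have := hg (Fin.succ_pos i); omega)
        (fun i j hij => hg (Fin.succ_lt_succ_iff.2 hij))
      rw [Matrix.det_succ_column_zero, Fin.sum_univ_succ, Finset.sum_eq_zero, add_zero]
      · by_cases hf0 : f 0 = 0
        · have := hA m (by omega) (fun i => f i.succ) h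
            (fun i j hij => hf (Fin.succ_lt_succ_iff.2 hij)) hh
          convert this using 1
          simp only [Fin.val_zero, pow_zero, one_mul, Matrix.submatrix_apply, hg0, hf0,
            LatticeTP.consUnit, if_true, Matrix.submatrix_submatrix]
          congr 1
          ext i j
          simp [hgh, LatticeTP.consUnit]
        · simp [hg0, LatticeTP.consUnit, hf0]
      · intro i _
        have : f i.succ ≠ 0 := by have := hf (Fin.succ_pos i); omega
        simp [hg0, LatticeTP.consUnit, this]
    · obtain ⟨h, hh, hgh⟩ := shift g
        (fun i => by have := hg.monotone (Fin.zero_le i); omega) hg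
      convert hA (m + 1) hm f h hf hh using 2
      ext i j
      simp [hgh, LatticeTP.consUnit]

variable (t ℓ : ℕ) (a : ℕ → ℕ → R) (b : ℕ → R)

/-- The part of the recurrence that involves the previous row. -/
def rowTransfer (v : ℕ → R) (k : ℕ) : R :=
  ∑ i ∈ range (ℓ + 1), if t + i ≤ k then a i k * v (k - (t + i)) else 0

theorem recMatrix_zero_eq : recMatrix t ℓ a b 0 = resolventStep b (Pi.single 0 1) := by
  ext k
  induction k with
  | zero => simp [recMatrix, resolventStep]
  | succ k ih => simp [recMatrix, resolventStep, ih]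

theorem recMatrix_succ_eq (n : ℕ) :
    recMatrix t ℓ a b (n + 1) = resolventStep b (rowTransfer t ℓ a (recMatrix t ℓ a b n)) := by
  ext k
  induction k with
  | zero =>
    rw [recMatrix, resolventStep, rowTransfer]
    refine Finset.sum_congr rfl fun i _ => ?_
    simp
  | succ k ih => rw [recMatrix, resolventStep, rowTransfer, ih]

/-- The shift by `t` amounts to deleting the first `t` columns of the band matrix, which leaves a
submatrix. -/
theorem rowTransfer_eq_sum (v : ℕ → R) (k : ℕ) :
    rowTransfer t ℓ a v k = ∑ j ∈ range (k + 1), bandMatrix ℓ a k (j + t) * v j := by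
  simp only [rowTransfer, bandMatrix, ite_mul, zero_mul]
  rw [← Finset.sum_filter, ← Finset.sum_filter]
  refine Finset.sum_bij' (fun i _ => k - (t + i)) (fun j _ => k - (j + t)) ?_ ?_ ?_ ?_ ?_
  · intro i hi
    simp only [Finset.mem_filter, Finset.mem_range] at hi ⊢
    omega
  · intro i hi
    simp only [Finset.mem_filter, Finset.mem_range] at hi ⊢
    omega
  · intro i hi
    simp only [Finset.mem_filter, Finset.mem_range] at hi ⊢
    omega
  · intro i hi
    simp only [Finset.mem_filter, Finset.mem_range] at hi ⊢
    omega
  · intro i hi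
    simp only [Finset.mem_filter, Finset.mem_range] at hi ⊢
    rw [show k - (k - (t + i) + t) = i by omega]

theorem MinorsMem.rowTransfer {A : Matrix ℕ ℕ R} (hA : MinorsMem N r A)
    (ha : MinorsMem N r (bandMatrix ℓ a)) :
    MinorsMem N r (fun k j => rowTransfer t ℓ a (fun i => A i j) k) := by
  simp only [rowTransfer_eq_sum]
  have : MinorsMem N r ((bandMatrix ℓ a).submatrix id (· + t)) :=
    ha.submatrix strictMono_id (fun i j h => Nat.add_lt_add_right h t)
  refine this.lower_mul hA fun i k h => ?_
  simp only [Matrix.submatrix_apply, bandMatrix, id]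
  rw [if_neg (by omega)]

/-- The transpose of the matrix formed by the first `m` rows of `recMatrix`, with zero columns
added. -/
def recMatrixTruncation : ℕ → Matrix ℕ ℕ R
  | 0 => 0
  | m + 1 => fun k j => resolventStep b (fun k => consUnit
      (fun k j => rowTransfer t ℓ a (fun i => recMatrixTruncation m i j) k) k j) k

/-- Truncation turns the self-referential equation for the transpose of `recMatrix` into an
induction in which each operation preserves `MinorsMem`. -/
theorem minorsMem_recMatrixTruncation (ha : MinorsMem N r (bandMatrix ℓ a))
    (hb : ∀ k, b k ∈ N) (m : ℕ) : MinorsMem N r (recMatrixTruncation t ℓ a b m) := by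
  induction m with
  | zero => exact minorsMem_zero
  | succ m ih => exact ((ih.rowTransfer t ℓ a ha).consUnit).resolventStep hb

theorem recMatrixTruncation_apply (m j : ℕ) (h : j < m) (k : ℕ) :
    recMatrixTruncation t ℓ a b m k j = recMatrix t ℓ a b j k := by
  induction m generalizing j k with
  | zero => omega
  | succ m ih =>
    rw [recMatrixTruncation]
    cases j with
    | zero =>
      rw [recMatrix_zero_eq]
      refine congrArg (fun v => resolventStep b v k) (funext fun k => ?_)
      simp [consUnit, Pi.single_apply]
    | succ j =>
      rw [recMatrix_succ_eq]
      refine congrArg (fun v => resolventStep b v k) (funext fun k => ?_)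
      simp only [consUnit]
      refine congrArg (fun v => rowTransfer t ℓ a v k) (funext fun i => ?_)
      exact ih j (by omega) i

theorem minorsMem_recMatrix (ha : MinorsMem N r (bandMatrix ℓ a)) (hb : ∀ k, b k ∈ N) :
    MinorsMem N r (recMatrix t ℓ a b) :=
  MinorsMem.congr_rows fun n => ⟨_, (minorsMem_recMatrixTruncation t ℓ a b ha hb (n + 1)).transpose,
    fun i hi j => recMatrixTruncation_apply t ℓ a b (n + 1) i (by omega) j⟩

end Recursive

/-! ### Periodic planar networks and Toeplitz matrices -/

theorem periodic_apply_mul_add {S : Type*} {w : ℕ → S} {P : ℕ} (hw : ∀ p, w (p + P) = w p)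
    (j p : ℕ) :
    w (P * j + p) = w p := by
  induction j with
  | zero => simp
  | succ j ih => rw [← ih, ← hw (P * j + p)]; congr 1; ring

section Network

variable {R : Type*} [CommRing R] {N : Subsemiring R} {r : ℕ}

/-- The composition of the first `m` steps with weights `d`, `c`, `e`. -/
def iterStep (d c e : ℕ → ℕ → R) : ℕ → (ℕ → R) → ℕ → R
  | 0, v => v
  | m + 1, v => step (d m) (c m) (e m) (iterStep d c e m v)

theorem iterStep_succ (d c e : ℕ → ℕ → R) (m : ℕ) (v : ℕ → R) :
    iterStep d c e (m + 1) v = step (d m) (c m) (e m) (iterStep d c e m v) := rfl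

theorem iterStep_congr {d c e d' c' e' : ℕ → ℕ → R} {m : ℕ} (hd : ∀ i < m, d i = d' i)
    (hc : ∀ i < m, c i = c' i) (he : ∀ i < m, e i = e' i) (v : ℕ → R) :
    iterStep d c e m v = iterStep d' c' e' m v := by
  induction m with
  | zero => rfl
  | succ m ih =>
    rw [iterStep_succ, iterStep_succ, ih (fun i h => hd i (by omega)) (fun i h => hc i (by omega))
      (fun i h => he i (by omega)), hd m (by omega), hc m (by omega), he m (by omega)]

theorem iterStep_add (d c e : ℕ → ℕ → R) (p m : ℕ) (v : ℕ → R) :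
    iterStep d c e (p + m) v = iterStep (fun i => d (p + i)) (fun i => c (p + i))
      (fun i => e (p + i)) m (iterStep d c e p v) := by
  induction m with
  | zero => rfl
  | succ m ih => rw [← add_assoc, iterStep_succ, iterStep_succ, ih]

/-- Weighted sums over lattice paths from `(0, 0)` to `(p, k)` with steps `(1, 0)`, `(1, 1)`, `(0, 1)`
into the points with first coordinate `p + 1`, weighted by `d p`, `c p`, `e p`. -/
def pathSum (d c e : ℕ → ℕ → R) (p : ℕ) : ℕ → R :=
  iterStep d c e p (Pi.single 0 1)

theorem pathSum_zero (d c e : ℕ → ℕ → R) : pathSum d c e 0 = Pi.single 0 1 := rfl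

theorem pathSum_succ (d c e : ℕ → ℕ → R) (p : ℕ) :
    pathSum d c e (p + 1) = step (d p) (c p) (e p) (pathSum d c e p) := rfl

/-- Weighted sums over lattice paths from `(q, 0)` to `(p, k)`, as a matrix in `p` and `q`. -/
def columnTransfer (d c e : ℕ → ℕ → R) : ℕ → Matrix ℕ ℕ R
  | 0 => fun p q => resolventStep (fun p => d (p - 1) 0) (fun i => (1 : Matrix ℕ ℕ R) i q) p
  | k + 1 => fun p q => step (fun p => if p = 0 then 0 else e (p - 1) (k + 1))
      (fun p => c (p - 1) (k + 1)) (fun p => d (p - 1) (k + 1))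
      (fun i => columnTransfer d c e k i q) p

variable {d c e : ℕ → ℕ → R}

/-- Raising `k` by one is again a `step`, with `e` as diagonal and `d` as recursive weight. At `p =
0` only the diagonal weight is read, and it is set to `0`; the junk values from `p - 1` in the other
two slots play no role. -/
theorem minorsMem_columnTransfer (hd : ∀ p k, d p k ∈ N) (hc : ∀ p k, c p k ∈ N)
    (he : ∀ p k, e p k ∈ N) (k : ℕ) : MinorsMem N r (columnTransfer d c e k) := by
  induction k with
  | zero => exact minorsMem_one.resolventStep fun _ => hd _ _
  | succ k ih =>
    exact ih.step (fun p => by split_ifs; exacts [zero_mem _, he _ _]) (fun _ => hc _ _)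
      (fun _ => hd _ _)

theorem columnTransfer_zero_zero (q : ℕ) :
    columnTransfer d c e 0 0 q = (1 : Matrix ℕ ℕ R) 0 q := rfl

theorem columnTransfer_zero_succ (p q : ℕ) : columnTransfer d c e 0 (p + 1) q =
    (1 : Matrix ℕ ℕ R) (p + 1) q + d p 0 * columnTransfer d c e 0 p q := rfl

theorem columnTransfer_succ_zero (k q : ℕ) : columnTransfer d c e (k + 1) 0 q = 0 :=
  zero_mul _

theorem columnTransfer_succ_succ (k p q : ℕ) : columnTransfer d c e (k + 1) (p + 1) q =
    e p (k + 1) * columnTransfer d c e k (p + 1) q + c p (k + 1) * columnTransfer d c e k p q +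
      d p (k + 1) * columnTransfer d c e (k + 1) p q := rfl

theorem columnTransfer_eq_zero (k p q : ℕ) (h : p < q) : columnTransfer d c e k p q = 0 := by
  induction k generalizing p with
  | zero =>
    induction p with
    | zero => rw [columnTransfer_zero_zero, Matrix.one_apply_ne h.ne]
    | succ p ih =>
      rw [columnTransfer_zero_succ, Matrix.one_apply_ne h.ne, ih (by omega), mul_zero, add_zero]
  | succ k ihk =>
    induction p with
    | zero => rw [columnTransfer_succ_zero]
    | succ p ih =>
      rw [columnTransfer_succ_succ, ihk _ h, ihk p (by omega), ih (by omega)]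
      simp only [mul_zero, add_zero]

/-- Periodicity translates paths starting at `(P * j, 0)` back to the origin. The condition `e (P -
1) = 0` forbids vertical steps on the starting line, so the initial vector there is the unit vector,
as for `pathSum`. -/
theorem columnTransfer_eq_pathSum {P : ℕ} (hP : 0 < P) (hd : ∀ p, d (p + P) = d p)
    (hc : ∀ p, c (p + P) = c p) (he : ∀ p, e (p + P) = e p) (he0 : e (P - 1) = 0) (k p j : ℕ) :
    columnTransfer d c e k (P * j + p) (P * j) = pathSum d c e p k := by
  have pred : ∀ s, P * j = s + 1 → e s = 0 := by
    intro s hs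
    cases j with
    | zero => simp at hs
    | succ j =>
      rw [Nat.mul_succ] at hs
      rw [← he0, ← periodic_apply_mul_add he j (P - 1)]
      congr 1
      omega
  induction k generalizing p with
  | zero =>
    induction p with
    | zero =>
      rw [add_zero, pathSum_zero, Pi.single_eq_same]
      rcases h : P * j with _ | s
      · rw [columnTransfer_zero_zero, Matrix.one_apply_eq]
      · rw [columnTransfer_zero_succ, columnTransfer_eq_zero 0 s (s + 1) (by omega), mul_zero,
          add_zero, Matrix.one_apply_eq]
    | succ p ih =>
      rw [← add_assoc, columnTransfer_zero_succ, ih, Matrix.one_apply_ne (by omega), pathSum_succ,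
        step_zero, periodic_apply_mul_add hd, zero_add]
  | succ k ihk =>
    induction p with
    | zero =>
      rw [add_zero, pathSum_zero, Pi.single_eq_of_ne (by omega)]
      rcases h : P * j with _ | s
      · rw [columnTransfer_succ_zero]
      · rw [columnTransfer_succ_succ, columnTransfer_eq_zero (k + 1) s (s + 1) (by omega),
          columnTransfer_eq_zero k s (s + 1) (by omega), pred s h]
        simp
    | succ p ih =>
      rw [← add_assoc, columnTransfer_succ_succ, ih, ihk, add_assoc (P * j) p 1, ihk, pathSum_succ,
        step_succ, periodic_apply_mul_add hd, periodic_apply_mul_add hc, periodic_apply_mul_add he]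
      ring

/-- In a periodic network, the sums over the paths to the points `(P * i + o, k)`, `i ≥ 0`,
form a Pólya frequency sequence. -/
theorem minorsMem_toeplitz_pathSum {P : ℕ} (he0 : e (P - 1) = 0)
    (hdN : ∀ p k, d p k ∈ N) (hcN : ∀ p k, c p k ∈ N) (heN : ∀ p k, e p k ∈ N)
    {o : ℕ} (ho : o < P) (k : ℕ) :
    MinorsMem N r (toeplitz fun i => pathSum (fun p => d (p % P)) (fun p => c (p % P))
      (fun p => e (p % P)) (P * i + o) k) := by
  have hP : 0 < P := by omega
  have h1 : StrictMono fun i => P * i := fun i j h => Nat.mul_lt_mul_of_pos_left h hP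
  have per : ∀ w : ℕ → ℕ → R, ∀ p, w ((p + P) % P) = w (p % P) := by simp
  have hlast : e ((P - 1) % P) = 0 := by rwa [Nat.mod_eq_of_lt (by omega)]
  refine ((minorsMem_columnTransfer (fun p => hdN (p % P)) (fun p => hcN (p % P))
    (fun p => heN (p % P)) k).submatrix (h1.add_const o) h1).congr
    fun i j => ?_
  simp only [Matrix.submatrix_apply, toeplitz]
  split_ifs with h
  · rw [← columnTransfer_eq_pathSum hP (per d) (per c) (per e) hlast k _ j]
    congr 1
    rw [Nat.mul_sub]
    have := Nat.mul_le_mul_left P h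
    omega
  -- Above the diagonal, `o < P` puts the endpoint `P * i + o` strictly before the start `P * j`.
  · refine columnTransfer_eq_zero _ _ _ ?_
    have := Nat.mul_le_mul_left P (show i + 1 ≤ j by omega)
    rw [Nat.mul_succ] at this
    omega

theorem pathSum_periodic (d c e : ℕ → ℕ → R) (P n m : ℕ) (hm : m ≤ P) :
    pathSum (fun p => d (p % P)) (fun p => c (p % P)) (fun p => e (p % P)) (P * n + m) =
      iterStep d c e m
        (pathSum (fun p => d (p % P)) (fun p => c (p % P)) (fun p => e (p % P)) (P * n)) := by
  have key : ∀ i < m, (P * n + i) % P = i := fun i hi => by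
    rw [Nat.mul_add_mod, Nat.mod_eq_of_lt (by omega)]
  rw [pathSum, iterStep_add]
  exact iterStep_congr (fun i hi => by rw [key i hi]) (fun i hi => by rw [key i hi])
    (fun i hi => by rw [key i hi]) _

end Network

/-! ### Bidiagonal factorizations and column sequences -/

section Factorization

variable {R : Type*} [CommRing R] {N : Subsemiring R} {r : ℕ}

theorem bidiagonalStep_one_zero (v : ℕ → R) : bidiagonalStep 1 0 v = v := by
  ext k; cases k <;> simp [bidiagonalStep]

theorem resolventStep_zero (v : ℕ → R) : resolventStep 0 v = v := by
  ext k; cases k <;> simp [resolventStep]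

theorem step_one_zero (e v : ℕ → R) : step 1 0 e v = resolventStep e v := by
  rw [step, bidiagonalStep_one_zero]

theorem step_without_rec (d c v : ℕ → R) : step d c 0 v = bidiagonalStep d c v := by
  rw [step, resolventStep_zero]

/-- The product of `m` bidiagonal matrices, applied to a column vector. -/
def iterBidiagonal (d c : ℕ → ℕ → R) : ℕ → (ℕ → R) → ℕ → R
  | 0, v => v
  | m + 1, v => bidiagonalStep (d m) (c m) (iterBidiagonal d c m v)

/-- The sequence `v`, delayed by `t`. -/
def delay (t : ℕ) (v : ℕ → R) (k : ℕ) : R := if t ≤ k then v (k - t) else 0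

theorem delay_zero (v : ℕ → R) : delay 0 v = v := by
  ext k; simp [delay]

theorem delay_succ (t : ℕ) (v : ℕ → R) : delay (t + 1) v = bidiagonalStep 0 1 (delay t v) := by
  ext k; cases k <;> simp [delay, bidiagonalStep]

theorem rowTransfer_eq_delay (t ℓ : ℕ) (a : ℕ → ℕ → R) (v : ℕ → R) :
    rowTransfer t ℓ a v = rowTransfer 0 ℓ a (delay t v) := by
  ext k
  refine Finset.sum_congr rfl fun i _ => ?_
  by_cases h : t + i ≤ k
  · simp only [delay]
    rw [if_pos h, if_pos (by omega), if_pos (by omega)]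
    congr 2
    omega
  · simp only [delay]
    rw [if_neg h]
    split_ifs
    · omega
    · rw [mul_zero]
    · rfl

/-- Lets a factorization of the operator `rowTransfer 0` be read as a factorization of the matrix,
column by column. -/
theorem bandMatrix_eq_rowTransfer (ℓ : ℕ) (a : ℕ → ℕ → R) (k j : ℕ) :
    bandMatrix ℓ a k j = rowTransfer 0 ℓ a (Pi.single j 1) k := by
  rw [rowTransfer_eq_sum]
  simp only [Pi.single_apply, mul_ite, mul_one, mul_zero, add_zero, Finset.sum_ite_eq',
    Finset.mem_range]
  split_ifs with h
  · rfl
  · rw [bandMatrix, if_neg (by omega)]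

variable {ℓ : ℕ} {a d c : ℕ → ℕ → R}

theorem minorsMem_iterBidiagonal (m : ℕ) (hd : ∀ i < m, ∀ k, d i k ∈ N)
    (hc : ∀ i < m, ∀ k, c i k ∈ N) :
    MinorsMem N r (fun k j => iterBidiagonal d c m (Pi.single j 1) k) := by
  induction m with
  | zero =>
    exact minorsMem_one.congr fun k j => by
      simp [iterBidiagonal, Matrix.one_apply, Pi.single_apply]
  | succ m ih =>
    exact (ih (fun i h => hd i (by omega)) fun i h => hc i (by omega)).bidiagonalStep
      (hd m (by omega)) (hc m (by omega))

theorem minorsMem_bandMatrix (h : ∀ v, rowTransfer 0 ℓ a v = iterBidiagonal d c ℓ v)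
    (hd : ∀ i < ℓ, ∀ k, d i k ∈ N) (hc : ∀ i < ℓ, ∀ k, c i k ∈ N) :
    MinorsMem N r (bandMatrix ℓ a) :=
  (minorsMem_iterBidiagonal ℓ hd hc).congr fun k j => by rw [bandMatrix_eq_rowTransfer, h]

/-- If the band matrix is a product of bidiagonal matrices, then the columns of the recursive
matrix are Pólya frequency sequences. -/
theorem minorsMem_toeplitz_column {t : ℕ} (ht : 1 ≤ t) {b : ℕ → R}
    (h : ∀ v, rowTransfer 0 ℓ a v = iterBidiagonal d c ℓ v)
    (hd : ∀ i < ℓ, ∀ k, d i k ∈ N) (hc : ∀ i < ℓ, ∀ k, c i k ∈ N) (hb : ∀ k, b k ∈ N) (k : ℕ) :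
    MinorsMem N r (toeplitz fun n => recMatrix t ℓ a b n k) := by
  -- One period: layer `0` is the resolvent of `b`, layers `1, …, t` are unit shifts, and layers `t
  -- + 1, …, t + ℓ` are the bidiagonal factors. Values beyond that are never reached.
  let D : ℕ → ℕ → R := fun m =>
    if m = 0 then 1 else if m ≤ t then 0 else if m ≤ t + ℓ then d (m - t - 1) else 0
  let C : ℕ → ℕ → R := fun m =>
    if m = 0 then 0 else if m ≤ t then 1 else if m ≤ t + ℓ then c (m - t - 1) else 0
  let E : ℕ → ℕ → R := fun m => if m = 0 then b else 0
  have h1 : ∀ v, iterStep D C E 1 v = resolventStep b v := fun v => by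
    simp [iterStep, D, C, E, step_one_zero]
  have h2 : ∀ m ≤ t, ∀ v, iterStep D C E (1 + m) v = delay m (resolventStep b v) := by
    intro m hm v
    induction m with
    | zero => rw [add_zero, h1, delay_zero]
    | succ m ih =>
      rw [← add_assoc, iterStep_succ, ih (by omega), delay_succ]
      simp only [D, C, E]
      rw [if_neg (by omega), if_pos (by omega), if_neg (by omega), if_pos (by omega),
        if_neg (by omega), step_without_rec]
  have h3 : ∀ m ≤ ℓ, ∀ v, iterStep D C E (1 + t + m) v =
      iterBidiagonal d c m (delay t (resolventStep b v)) := by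
    intro m hm v
    induction m with
    | zero => rw [add_zero, h2 t le_rfl, iterBidiagonal]
    | succ m ih =>
      rw [← add_assoc, iterStep_succ, ih (by omega), iterBidiagonal]
      simp only [D, C, E]
      rw [if_neg (by omega), if_neg (by omega), if_pos (by omega), if_neg (by omega),
        if_neg (by omega), if_pos (by omega), if_neg (by omega), step_without_rec,
        show 1 + t + m - t - 1 = m by omega]
  let P := 1 + t + ℓ
  -- At position `P * n` the network carries row `n` before its resolvent is applied.
  have h4 : ∀ n, resolventStep b (pathSum (fun p => D (p % P)) (fun p => C (p % P))
      (fun p => E (p % P)) (P * n)) = recMatrix t ℓ a b n := by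
    intro n
    induction n with
    | zero => rw [mul_zero, pathSum_zero, recMatrix_zero_eq]
    | succ n ih =>
      rw [Nat.mul_succ, pathSum_periodic _ _ _ _ _ _ le_rfl, h3 ℓ le_rfl, ih, recMatrix_succ_eq,
        rowTransfer_eq_delay, h]
  -- Offset `1` reads each period just after the resolvent layer. Since `1 ≤ t`, the last layer of
  -- the period is not layer `0`, so it has no vertical steps.
  have key := minorsMem_toeplitz_pathSum (N := N) (r := r) (d := D) (c := C) (e := E) (P := P)
    (by simp only [E]; rw [if_neg (by omega)])
    (fun p k => by
      simp only [D]
      split_ifs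
      exacts [one_mem _, zero_mem _, hd _ (by omega) _, zero_mem _])
    (fun p k => by
      simp only [C]
      split_ifs
      exacts [zero_mem _, one_mem _, hc _ (by omega) _, zero_mem _])
    (fun p k => by
      simp only [E]
      split_ifs
      exacts [hb _, zero_mem _]) (o := 1) (by omega) k
  refine key.congr fun i j => ?_
  congr 1
  ext n
  rw [pathSum_periodic _ _ _ _ _ _ (by omega), h1, h4]

theorem rowTransfer_one (a : ℕ → ℕ → R) (v : ℕ → R) :
    rowTransfer 0 1 a v = iterBidiagonal (fun _ => a 0) (fun _ => a 1) 1 v := by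
  ext k
  cases k <;> simp [rowTransfer, Finset.sum_range_succ, iterBidiagonal, bidiagonalStep]

/-- The hypotheses are the entries of the product of the bidiagonal matrices of `(α, β)` and `(lam,
mu)`. -/
theorem rowTransfer_two {a : ℕ → ℕ → R} {α β lam mu : ℕ → R} (h0 : ∀ k, a 0 k = α k * lam k)
    (h1 : ∀ k, 1 ≤ k → a 1 k = α k * mu k + β k * lam (k - 1))
    (h2 : ∀ k, 2 ≤ k → a 2 k = β k * mu (k - 1)) (v : ℕ → R) :
    rowTransfer 0 2 a v = iterBidiagonal (fun i => if i = 0 then lam else α)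
      (fun i => if i = 0 then mu else β) 2 v := by
  ext k
  rcases k with _ | _ | k
  · simp [rowTransfer, iterBidiagonal, bidiagonalStep, h0]
    ring
  · simp [rowTransfer, Finset.sum_range_succ, iterBidiagonal, bidiagonalStep, h0, h1]
    ring
  · simp [rowTransfer, Finset.sum_range_succ, iterBidiagonal, bidiagonalStep, h0, h1, h2]
    ring

end Factorization

/-! ### Constant weights: generating functions, rows and slanted sequences -/

section ConstantWeights

variable {R : Type*} [CommRing R] {N : Subsemiring R} {r : ℕ}

/-- The power series of `1 / (1 - e z)`. -/
def geomSeries (e : R) : PowerSeries R := PowerSeries.mk fun k => e ^ k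

/-- The power series of `d + c z`. -/
noncomputable def linearSeries (d c : R) : PowerSeries R :=
  PowerSeries.C d + PowerSeries.C c * PowerSeries.X

theorem mk_resolventStep_mul (e : R) (v : ℕ → R) :
    PowerSeries.mk (resolventStep (fun _ => e) v) * (1 - PowerSeries.C e * PowerSeries.X) =
      PowerSeries.mk v := by
  ext k
  rw [mul_sub, mul_one, mul_comm (PowerSeries.C e), ← mul_assoc]
  cases k with
  | zero => simp [resolventStep]
  | succ k =>
    rw [map_sub, PowerSeries.coeff_mul_C, PowerSeries.coeff_succ_mul_X]
    simp [resolventStep, mul_comm]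

theorem geomSeries_eq (e : R) :
    geomSeries e = PowerSeries.mk (resolventStep (fun _ => e) (Pi.single 0 1)) := by
  ext k
  rw [geomSeries, PowerSeries.coeff_mk, PowerSeries.coeff_mk]
  induction k with
  | zero => simp [resolventStep]
  | succ k ih => simp [resolventStep, ← ih, pow_succ, mul_comm]

theorem mk_single_zero : PowerSeries.mk (Pi.single 0 1 : ℕ → R) = 1 := by
  ext k
  rw [PowerSeries.coeff_mk, PowerSeries.coeff_one, Pi.single_apply]

theorem geomSeries_mul (e : R) :
    geomSeries e * (1 - PowerSeries.C e * PowerSeries.X) = 1 := by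
  rw [geomSeries_eq, mk_resolventStep_mul, mk_single_zero]

theorem mk_resolventStep (e : R) (v : ℕ → R) :
    PowerSeries.mk (resolventStep (fun _ => e) v) = geomSeries e * PowerSeries.mk v := by
  rw [← mk_resolventStep_mul e v, mul_comm, mul_assoc, mul_comm _ (geomSeries e), geomSeries_mul,
    mul_one]

theorem mk_bidiagonalStep (d c : R) (v : ℕ → R) :
    PowerSeries.mk (bidiagonalStep (fun _ => d) (fun _ => c) v) =
      linearSeries d c * PowerSeries.mk v := by
  ext k
  rw [linearSeries, add_mul, mul_assoc, mul_comm PowerSeries.X]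
  cases k with
  | zero => simp [bidiagonalStep]
  | succ k => simp [bidiagonalStep, PowerSeries.coeff_succ_mul_X]

theorem mk_step (d c e : R) (v : ℕ → R) :
    PowerSeries.mk (step (fun _ => d) (fun _ => c) (fun _ => e) v) =
      geomSeries e * linearSeries d c * PowerSeries.mk v := by
  rw [step, mk_resolventStep, mk_bidiagonalStep, mul_assoc]

theorem mk_iterStep (d c e : ℕ → R) (m : ℕ) (v : ℕ → R) :
    PowerSeries.mk (iterStep (fun i _ => d i) (fun i _ => c i) (fun i _ => e i) m v) =
      (∏ i ∈ range m, geomSeries (e i) * linearSeries (d i) (c i)) * PowerSeries.mk v := by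
  induction m with
  | zero => simp [iterStep]
  | succ m ih => rw [iterStep_succ, mk_step, ih, Finset.prod_range_succ]; ring

theorem mk_pathSum (d c e : ℕ → R) (m : ℕ) :
    PowerSeries.mk (pathSum (fun i _ => d i) (fun i _ => c i) (fun i _ => e i) m) =
      ∏ i ∈ range m, geomSeries (e i) * linearSeries (d i) (c i) := by
  rw [pathSum, mk_iterStep, mk_single_zero, mul_one]

theorem mk_iterBidiagonal (d c : ℕ → R) (m : ℕ) (v : ℕ → R) :
    PowerSeries.mk (iterBidiagonal (fun i _ => d i) (fun i _ => c i) m v) =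
      (∏ i ∈ range m, linearSeries (d i) (c i)) * PowerSeries.mk v := by
  induction m with
  | zero => simp [iterBidiagonal]
  | succ m ih => rw [iterBidiagonal, mk_bidiagonalStep, ih, Finset.prod_range_succ]; ring

theorem linearSeries_zero_one : linearSeries (0 : R) 1 = PowerSeries.X := by
  simp [linearSeries]

theorem linearSeries_one_zero : linearSeries (1 : R) 0 = 1 := by
  simp [linearSeries]

theorem geomSeries_zero : geomSeries (0 : R) = 1 := by
  simpa using geomSeries_mul (0 : R)

theorem mk_rowTransfer {ℓ : ℕ} {w : ℕ → ℕ → R} (hw : ∀ i ≤ ℓ, ∀ k, w i k = w i 0) (t : ℕ)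
    (v : ℕ → R) : PowerSeries.mk (rowTransfer t ℓ w v) =
      PowerSeries.X ^ t *
        (∑ i ∈ range (ℓ + 1), PowerSeries.C (w i 0) * PowerSeries.X ^ i) * PowerSeries.mk v := by
  ext k
  rw [PowerSeries.coeff_mk, rowTransfer, Finset.mul_sum, Finset.sum_mul, map_sum]
  refine Finset.sum_congr rfl fun i hi => ?_
  rw [show PowerSeries.X ^ t * (PowerSeries.C (w i 0) * PowerSeries.X ^ i) * PowerSeries.mk v =
    PowerSeries.C (w i 0) * (PowerSeries.X ^ (t + i) * PowerSeries.mk v) by ring,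
    PowerSeries.coeff_C_mul, PowerSeries.coeff_X_pow_mul', mul_ite, mul_zero,
    PowerSeries.coeff_mk, hw i (by simpa [Nat.lt_succ_iff] using hi) k]

variable {ℓ : ℕ} {w : ℕ → ℕ → R} {A B : ℕ → R}

/-- The product on the right is independent of `k`, hence so is each coefficient on the left. -/
theorem weight_eq_of_factorization
    (hw : ∀ k, ∑ i ∈ range (ℓ + 1), Polynomial.C (w i k) * (Polynomial.X : Polynomial R) ^ i =
      ∏ j ∈ range ℓ, (Polynomial.C (A j) * Polynomial.X + Polynomial.C (B j)))
    (i : ℕ) (hi : i ≤ ℓ) (k : ℕ) : w i k = w i 0 := by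
  have h : ∀ k, (∑ i ∈ range (ℓ + 1),
      Polynomial.C (w i k) * (Polynomial.X : Polynomial R) ^ i).coeff i = w i k := by
    intro k
    simp [Polynomial.finsetSum_coeff, Polynomial.coeff_C_mul, Polynomial.coeff_X_pow]
    omega
  rw [← h k, ← h 0, hw, hw]

theorem weightSeries_eq_prod
    (hw : ∀ k, ∑ i ∈ range (ℓ + 1), Polynomial.C (w i k) * (Polynomial.X : Polynomial R) ^ i =
      ∏ j ∈ range ℓ, (Polynomial.C (A j) * Polynomial.X + Polynomial.C (B j))) :
    ∑ i ∈ range (ℓ + 1), PowerSeries.C (w i 0) * PowerSeries.X ^ i =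
      ∏ j ∈ range ℓ, linearSeries (B j) (A j) := by
  have := congrArg (Polynomial.coeToPowerSeries.ringHom (R := R)) (hw 0)
  simpa [linearSeries, map_sum, map_prod, add_comm] using this

/-- Both operators multiply the generating function of `v` by the same polynomial. -/
theorem rowTransfer_of_factorization
    (hw : ∀ k, ∑ i ∈ range (ℓ + 1), Polynomial.C (w i k) * (Polynomial.X : Polynomial R) ^ i =
      ∏ j ∈ range ℓ, (Polynomial.C (A j) * Polynomial.X + Polynomial.C (B j))) (v : ℕ → R) :
    rowTransfer 0 ℓ w v = iterBidiagonal (fun j _ => B j) (fun j _ => A j) ℓ v := by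
  have h : PowerSeries.mk (rowTransfer 0 ℓ w v) =
      PowerSeries.mk (iterBidiagonal (fun j _ => B j) (fun j _ => A j) ℓ v) := by
    rw [mk_rowTransfer (weight_eq_of_factorization hw), mk_iterBidiagonal, pow_zero, one_mul,
      weightSeries_eq_prod hw]
  ext k
  simpa using congrArg (PowerSeries.coeff k) h

/-- Row `0` is the geometric series, and each further row contributes a factor `X ^ t`, the weight
polynomial and another geometric series. -/
theorem mk_recMatrix (hw : ∀ i ≤ ℓ, ∀ k, w i k = w i 0)
    (hF : ∑ i ∈ range (ℓ + 1), PowerSeries.C (w i 0) * PowerSeries.X ^ i =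
      ∏ j ∈ range ℓ, linearSeries (B j) (A j)) (t : ℕ) (γ : R) (n : ℕ) :
    PowerSeries.mk (recMatrix t ℓ w (fun _ => γ) n) =
      PowerSeries.X ^ (t * n) * (∏ j ∈ range ℓ, linearSeries (B j) (A j)) ^ n *
        geomSeries γ ^ (n + 1) := by
  induction n with
  | zero => simp [recMatrix_zero_eq, geomSeries_eq]
  | succ n ih =>
    rw [recMatrix_succ_eq, mk_resolventStep, mk_rowTransfer hw, ih, hF]
    ring

theorem recMatrix_eq_coeff (hw : ∀ i ≤ ℓ, ∀ k, w i k = w i 0)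
    (hF : ∑ i ∈ range (ℓ + 1), PowerSeries.C (w i 0) * PowerSeries.X ^ i =
      ∏ j ∈ range ℓ, linearSeries (B j) (A j)) (t : ℕ) (γ : R) (n k : ℕ) :
    recMatrix t ℓ w (fun _ => γ) n k = if t * n ≤ k then
      PowerSeries.coeff (k - t * n) ((∏ j ∈ range ℓ, linearSeries (B j) (A j)) ^ n *
        geomSeries γ ^ (n + 1)) else 0 := by
  rw [← PowerSeries.coeff_X_pow_mul', ← mul_assoc, ← mk_recMatrix hw hF, PowerSeries.coeff_mk]

/-- The Toeplitz matrix of the coefficients of a product of power series is the product of the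
Toeplitz matrices. -/
theorem toeplitz_coeff_mul (φ ψ : PowerSeries R) (i j : ℕ) :
    toeplitz (fun k => PowerSeries.coeff k (φ * ψ)) i j = ∑ k ∈ range (i + 1),
      toeplitz (fun k => PowerSeries.coeff k φ) i k *
        toeplitz (fun k => PowerSeries.coeff k ψ) k j := by
  by_cases h : j ≤ i
  · obtain ⟨n, rfl⟩ := Nat.exists_eq_add_of_le h
    rw [add_assoc, Finset.sum_range_add, Finset.sum_eq_zero, zero_add, toeplitz, if_pos h,
      Nat.add_sub_cancel_left, mul_comm, PowerSeries.coeff_mul,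
      Finset.Nat.sum_antidiagonal_eq_sum_range_succ
        (fun p q => PowerSeries.coeff p ψ * PowerSeries.coeff q φ)]
    · refine Finset.sum_congr rfl fun k hk => ?_
      have := Finset.mem_range.1 hk
      rw [toeplitz, toeplitz, if_pos (by omega), if_pos (by omega), mul_comm,
        Nat.add_sub_cancel_left, Nat.add_sub_add_left]
    · intro k hk
      have := Finset.mem_range.1 hk
      rw [mul_comm, toeplitz, if_neg (by omega), zero_mul]
  · rw [toeplitz, if_neg h, Finset.sum_eq_zero]
    intro k hk
    have := Finset.mem_range.1 hk
    rw [mul_comm, toeplitz, if_neg (by omega), zero_mul]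

theorem MinorsMem.toeplitz_mul {φ ψ : PowerSeries R}
    (hφ : MinorsMem N r (toeplitz fun k => PowerSeries.coeff k φ))
    (hψ : MinorsMem N r (toeplitz fun k => PowerSeries.coeff k ψ)) :
    MinorsMem N r (toeplitz fun k => PowerSeries.coeff k (φ * ψ)) :=
  (hφ.lower_mul hψ fun i k h => by rw [toeplitz, if_neg (by omega)]).congr
    fun i j => (toeplitz_coeff_mul φ ψ i j).symm

theorem minorsMem_toeplitz_linearSeries {d c : R} (hd : d ∈ N) (hc : c ∈ N) :
    MinorsMem N r (toeplitz fun k => PowerSeries.coeff k (linearSeries d c)) := by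
  refine (minorsMem_bidiagonal (d := fun _ => d) (c := fun _ => c) (fun _ => hd)
    (fun _ => hc)).congr fun i j => ?_
  rw [bidiagonal, toeplitz]
  by_cases h : j ≤ i
  · obtain ⟨n, rfl⟩ := Nat.exists_eq_add_of_le h
    rw [if_pos h, Nat.add_sub_cancel_left]
    rcases n with _ | _ | n
    · simp [linearSeries]
    · simp [linearSeries]
    · simp [linearSeries]
  · rw [if_neg h, if_neg (by omega), if_neg (by omega)]

/-- This Toeplitz matrix is the resolvent with constant weight `e` applied to the identity. -/
theorem minorsMem_toeplitz_geomSeries {e : R} (he : e ∈ N) :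
    MinorsMem N r (toeplitz fun k => PowerSeries.coeff k (geomSeries e)) := by
  refine ((minorsMem_one (N := N)).resolventStep (e := fun _ => e) fun _ => he).congr
    fun i j => ?_
  have h0 : ∀ i < j, resolventStep (fun _ => e) (fun i => (1 : Matrix ℕ ℕ R) i j) i = 0 := by
    intro i hi
    induction i with
    | zero => rw [resolventStep, Matrix.one_apply_ne hi.ne]
    | succ i ih => rw [resolventStep, Matrix.one_apply_ne hi.ne, ih (by omega), mul_zero, add_zero]
  rw [toeplitz]
  split_ifs with h
  · obtain ⟨n, rfl⟩ := Nat.exists_eq_add_of_le h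
    rw [Nat.add_sub_cancel_left, geomSeries, PowerSeries.coeff_mk]
    clear h
    induction n with
    | zero =>
      rcases j with _ | j
      · simp [resolventStep]
      · rw [add_zero, resolventStep, h0 j (by omega)]
        simp
    | succ n ih =>
      rw [← add_assoc, resolventStep, ih, Matrix.one_apply_ne (by omega), zero_add, pow_succ']
  · exact h0 i (by omega)

theorem minorsMem_toeplitz_one :
    MinorsMem N r (toeplitz fun k => PowerSeries.coeff k (1 : PowerSeries R)) := by
  simpa [linearSeries_one_zero] using
    minorsMem_toeplitz_linearSeries (N := N) (r := r) (one_mem N) (zero_mem N)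

theorem minorsMem_toeplitz_prod {ι : Type*} (s : Finset ι) (φ : ι → PowerSeries R)
    (h : ∀ i ∈ s, MinorsMem N r (toeplitz fun k => PowerSeries.coeff k (φ i))) :
    MinorsMem N r (toeplitz fun k => PowerSeries.coeff k (∏ i ∈ s, φ i)) :=
  Finset.prod_induction φ (fun φ => MinorsMem N r (toeplitz fun k => PowerSeries.coeff k φ))
    (fun _ _ => MinorsMem.toeplitz_mul) minorsMem_toeplitz_one h

theorem MinorsMem.toeplitz_pow {φ : PowerSeries R}
    (h : MinorsMem N r (toeplitz fun k => PowerSeries.coeff k φ)) (n : ℕ) :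
    MinorsMem N r (toeplitz fun k => PowerSeries.coeff k (φ ^ n)) := by
  simpa using minorsMem_toeplitz_prod (range n) (fun _ => φ) fun _ _ => h

/-- The rows of the recursive matrix with constant factorizing weights are Pólya frequency
sequences. -/
theorem minorsMem_toeplitz_row (hw : ∀ i ≤ ℓ, ∀ k, w i k = w i 0)
    (hF : ∑ i ∈ range (ℓ + 1), PowerSeries.C (w i 0) * PowerSeries.X ^ i =
      ∏ j ∈ range ℓ, linearSeries (B j) (A j))
    (hA : ∀ j, A j ∈ N) (hB : ∀ j, B j ∈ N) (t : ℕ) {γ : R} (hγ : γ ∈ N) (n : ℕ) :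
    MinorsMem N r (toeplitz (recMatrix t ℓ w (fun _ => γ) n)) := by
  have hX : MinorsMem N r (toeplitz fun k => PowerSeries.coeff k (PowerSeries.X : PowerSeries R)) := by
    simpa [linearSeries_zero_one] using
      minorsMem_toeplitz_linearSeries (N := N) (r := r) (zero_mem N) (one_mem N)
  have := ((hX.toeplitz_pow (t * n)).toeplitz_mul
    ((minorsMem_toeplitz_prod (range ℓ) (fun j => linearSeries (B j) (A j)) fun j _ =>
      minorsMem_toeplitz_linearSeries (hB j) (hA j)).toeplitz_pow n)).toeplitz_mul
    ((minorsMem_toeplitz_geomSeries (N := N) hγ).toeplitz_pow (n + 1))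
  rw [← mk_recMatrix hw hF] at this
  simpa using this

theorem prod_range_mod {S : Type*} [CommMonoid S] (g : ℕ → S) (P n o : ℕ) (ho : o ≤ P) :
    ∏ i ∈ range (P * n + o), g (i % P) = (∏ i ∈ range P, g i) ^ n * ∏ i ∈ range o, g i := by
  have key : ∀ n, ∀ o ≤ P, ∏ i ∈ range o, g ((P * n + i) % P) = ∏ i ∈ range o, g i := by
    intro n o ho
    refine Finset.prod_congr rfl fun i hi => ?_
    rw [Nat.mul_add_mod, Nat.mod_eq_of_lt (by have := Finset.mem_range.1 hi; omega)]
  induction n generalizing o with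
  | zero => simpa using key 0 o ho
  | succ n ih =>
    rw [Finset.prod_range_add, key _ o ho, Nat.mul_succ, ih P le_rfl, pow_succ]

/-- Slanted sequences of entries of the recursive matrix with constant factorizing weights are
Pólya frequency sequences. -/
theorem minorsMem_toeplitz_slanted (hw : ∀ i ≤ ℓ, ∀ k, w i k = w i 0)
    (hF : ∑ i ∈ range (ℓ + 1), PowerSeries.C (w i 0) * PowerSeries.X ^ i =
      ∏ j ∈ range ℓ, linearSeries (B j) (A j))
    (hA : ∀ j, A j ∈ N) (hB : ∀ j, B j ∈ N) {t : ℕ} {γ : R} (hγ : γ ∈ N) {n k σ δ : ℕ}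
    (hn : n < σ) (hδ : δ < t * σ) :
    MinorsMem N r (toeplitz fun i => recMatrix t ℓ w (fun _ => γ) (n + σ * i) (k + δ * i)) := by
  have hcoef : ∀ i, t * (n + σ * i) = t * n + δ * i + (t * σ - δ) * i := by
    intro i
    obtain ⟨ρ, hρ⟩ := Nat.exists_eq_add_of_le hδ.le
    rw [mul_add, ← mul_assoc, hρ, Nat.add_sub_cancel_left]
    ring
  -- The coefficient index `k - t n - (t σ - δ) i` decreases with `i`, so if it is negative at `i =
  -- 0` the whole sequence vanishes.
  by_cases hk : k < t * n
  · refine (minorsMem_zero (N := N) (r := r)).congr fun i j => ?_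
    rw [toeplitz]
    split_ifs
    · rw [recMatrix_eq_coeff hw hF, if_neg, Matrix.zero_apply]
      rw [hcoef]
      omega
    · rfl
  · obtain ⟨κ, rfl⟩ := Nat.exists_eq_add_of_le (not_lt.1 hk)
    -- One period consists of `σ` blocks of `Q` layers (a geometric series, then `ℓ` linear
    -- factors), followed by all `ρ = t σ - δ` shifts. Postponing the shifts is harmless because
    -- constant-weight layers commute. The net shift `ρ` per period absorbs the slant, so a fixed
    -- coefficient `κ = k - t n` is read.
    let Q := 1 + ℓ
    let ρ := t * σ - δ
    let P := Q * σ + ρ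
    let D : ℕ → R := fun m => if m < Q * σ then (if m % Q = 0 then 1 else B (m % Q - 1)) else 0
    let C : ℕ → R := fun m => if m < Q * σ then (if m % Q = 0 then 0 else A (m % Q - 1)) else 1
    let E : ℕ → R := fun m => if m < Q * σ then (if m % Q = 0 then γ else 0) else 0
    let S : ℕ → PowerSeries R := fun m => geomSeries (E m) * linearSeries (D m) (C m)
    let F : PowerSeries R := ∏ j ∈ range ℓ, linearSeries (B j) (A j)
    let S' : ℕ → PowerSeries R := fun m =>
      if m = 0 then geomSeries γ else linearSeries (B (m - 1)) (A (m - 1))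
    have hS : ∀ m < Q * σ, S m = S' (m % Q) := by
      intro m hm
      simp only [S, S', D, C, E, if_pos hm]
      split_ifs
      · rw [linearSeries_one_zero, mul_one]
      · rw [geomSeries_zero, one_mul]
    have hS' : ∏ i ∈ range Q, S' i = geomSeries γ * F := by
      simp only [Q, S', F]
      rw [Finset.prod_range_add]
      simp [add_comm 1]
    have h1 : ∀ i o, o ≤ Q → Q * i + o ≤ Q * σ →
        ∏ m ∈ range (Q * i + o), S m = (geomSeries γ * F) ^ i * ∏ m ∈ range o, S' m := by
      intro i o ho hi
      rw [← hS', ← prod_range_mod S' Q i o ho]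
      exact Finset.prod_congr rfl fun m hm => hS m (by have := Finset.mem_range.1 hm; omega)
    have h2 : ∏ m ∈ range P, S m = (geomSeries γ * F) ^ σ * PowerSeries.X ^ ρ := by
      simp only [P]
      rw [Finset.prod_range_add, ← add_zero (Q * σ), h1 σ 0 (by omega) (by omega)]
      have : ∀ x ∈ range ρ, S (Q * σ + 0 + x) = PowerSeries.X := by
        intro x _
        simp only [S, D, C, E]
        rw [if_neg (by omega), if_neg (by omega), if_neg (by omega), geomSeries_zero, one_mul,
          linearSeries_zero_one]
      rw [Finset.prod_congr rfl this]
      simp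
    have hQn : Q * n + 1 ≤ Q * σ := by
      have := Nat.mul_le_mul_left Q (show n + 1 ≤ σ from hn)
      rw [Nat.mul_succ] at this
      omega
    have hρ : 0 < ρ := by omega
    -- The offset covers `n` blocks and one further geometric layer, for the exponent `n + 1`; it
    -- lies in the period because `n < σ`. As `0 < ρ`, the last layer is a shift, so its `e` is
    -- zero.
    have key := minorsMem_toeplitz_pathSum (N := N) (r := r) (d := fun m _ => D m)
      (c := fun m _ => C m) (e := fun m _ => E m) (P := P)
      (by
        ext k
        simp only [E, P]
        rw [if_neg (by omega)]
        rfl)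
      (fun p k => by
        simp only [D]
        split_ifs
        exacts [one_mem _, hB _, zero_mem _])
      (fun p k => by
        simp only [C]
        split_ifs
        exacts [zero_mem _, hA _, one_mem _])
      (fun p k => by
        simp only [E]
        split_ifs
        exacts [hγ, zero_mem _, zero_mem _]) (o := Q * n + 1) (by omega) κ
    refine key.congr fun i j => ?_
    congr 1
    ext i
    rw [recMatrix_eq_coeff hw hF, hcoef, ← PowerSeries.coeff_mk κ (pathSum _ _ _ _),
      mk_pathSum (fun p => D (p % P)) (fun p => C (p % P)) (fun p => E (p % P)),
      prod_range_mod S P i (Q * n + 1) (by omega), h2, h1 n 1 (by omega) hQn]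
    rw [show ((geomSeries γ * F) ^ σ * PowerSeries.X ^ ρ) ^ i *
      ((geomSeries γ * F) ^ n * ∏ m ∈ range 1, S' m) =
        PowerSeries.X ^ (ρ * i) * (F ^ (n + σ * i) * geomSeries γ ^ (n + σ * i + 1)) by
      simp only [Finset.prod_range_one, S', if_true]
      ring]
    rw [PowerSeries.coeff_X_pow_mul']
    change (if (t * σ - δ) * i ≤ κ then
      PowerSeries.coeff (κ - (t * σ - δ) * i) _ else 0) = _
    generalize (t * σ - δ) * i = s
    by_cases h : s ≤ κ
    · rw [if_pos h, if_pos (by omega),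
        show t * n + κ + δ * i - (t * n + δ * i + s) = κ - s by omega]
    · rw [if_neg h, if_neg (by omega)]

end ConstantWeights

/-! ### Explicit formula and bivariate generating function -/

section Formulas

variable {R : Type*} [CommRing R]

theorem geomSeries_pow_succ (e : R) (n : ℕ) :
    geomSeries e ^ (n + 1) = PowerSeries.mk fun i => ((n + i).choose i : R) * e ^ i := by
  have : geomSeries e = PowerSeries.rescale e (PowerSeries.mk 1) := by
    ext k
    simp [geomSeries, PowerSeries.coeff_rescale]
  rw [this, ← map_pow, PowerSeries.mk_one_pow_eq_mk_choose_add]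
  ext k
  rw [PowerSeries.coeff_rescale, PowerSeries.coeff_mk, PowerSeries.coeff_mk, mul_comm,
    Nat.choose_symm_add]

theorem linearSeries_pow (d c : R) (n : ℕ) :
    linearSeries d c ^ n = ∑ i ∈ range (n + 1),
      PowerSeries.C ((n.choose i : R) * c ^ i * d ^ (n - i)) * PowerSeries.X ^ i := by
  rw [linearSeries, add_comm, add_pow]
  refine Finset.sum_congr rfl fun i _ => ?_
  simp only [map_mul, map_pow, map_natCast]
  ring

theorem prod_linearSeries_pow {ι : Type*} [Fintype ι] [DecidableEq ι] (d c : ι → R) (n : ℕ) :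
    (∏ j, linearSeries (d j) (c j)) ^ n =
      ∑ p ∈ Fintype.piFinset fun _ : ι => range (n + 1),
        PowerSeries.C (∏ j, ((n.choose (p j) : R) * c j ^ p j * d j ^ (n - p j))) *
          PowerSeries.X ^ (∑ j, p j) := by
  rw [← Finset.prod_pow, Finset.prod_congr rfl fun j _ => linearSeries_pow (d j) (c j) n,
    Finset.prod_univ_sum]
  refine Finset.sum_congr rfl fun p _ => ?_
  rw [Finset.prod_mul_distrib, ← map_prod, Finset.prod_pow_eq_pow_sum]

theorem recMatrix_eq_sum_of_series {ℓ : ℕ} {w : ℕ → ℕ → R} {c d : Fin ℓ → R} {t : ℕ} {γ : R}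
    {n : ℕ} (h : PowerSeries.mk (recMatrix t ℓ w (fun _ => γ) n) =
      PowerSeries.X ^ (t * n) * (∏ j, linearSeries (d j) (c j)) ^ n * geomSeries γ ^ (n + 1))
    (k : ℕ) :
    recMatrix t ℓ w (fun _ => γ) n k =
      ∑ p ∈ (range (k + 1) ×ˢ Fintype.piFinset fun _ : Fin ℓ => range (n + 1)).filter
          (fun p : ℕ × (Fin ℓ → ℕ) => (p.1 : ℤ) + ∑ j, (p.2 j : ℤ) = (k : ℤ) - t * n),
        ((n + p.1).choose p.1 : R) * γ ^ p.1 *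
          ∏ j, ((n.choose (p.2 j) : R) * c j ^ p.2 j * d j ^ (n - p.2 j)) := by
  rw [← PowerSeries.coeff_mk k (recMatrix t ℓ w (fun _ => γ) n), h, prod_linearSeries_pow,
    Finset.mul_sum, Finset.sum_mul, map_sum, geomSeries_pow_succ, Finset.sum_filter,
    Finset.sum_product_right]
  refine Finset.sum_congr rfl fun p _ => ?_
  rw [show ∀ (x : R) (g : PowerSeries R) (s : ℕ), PowerSeries.X ^ (t * n) *
    (PowerSeries.C x * PowerSeries.X ^ s) * g =
      PowerSeries.C x * (PowerSeries.X ^ (t * n + s) * g) from fun x g s => by ring,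
    PowerSeries.coeff_C_mul, PowerSeries.coeff_X_pow_mul']
  have hcond : ∀ i : ℕ, ((i : ℤ) + ∑ j, (p j : ℤ) = (k : ℤ) - t * n) ↔
      i + (t * n + ∑ j, p j) = k := by
    intro i
    rw [← Nat.cast_inj (R := ℤ)]
    push_cast
    constructor <;> intro h <;> linarith
  simp only [hcond]
  split_ifs with hk
  -- Once the exponents `p` are chosen, the power of `γ` is forced.
  · rw [Finset.sum_eq_single (k - (t * n + ∑ j, p j))]
    · rw [if_pos (by omega), PowerSeries.coeff_mk, mul_comm]
    · intro i _ hi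
      rw [if_neg (by omega)]
    · intro hi
      exact absurd (Finset.mem_range.2 (by omega)) hi
  · rw [mul_zero]
    exact (Finset.sum_eq_zero fun i _ => if_neg (by omega)).symm

theorem genFun_recMatrix_mul {ℓ : ℕ} {w : ℕ → ℕ → R} (hw : ∀ i ≤ ℓ, ∀ k k', w i k = w i k')
    (t : ℕ) (γ : R) (k : ℕ) :
    genFun (recMatrix t ℓ w fun _ => γ) *
      (1 - MvPowerSeries.C γ * MvPowerSeries.X 1 - MvPowerSeries.X 0 *
        ∑ i ∈ range (ℓ + 1), MvPowerSeries.C (w i k) * MvPowerSeries.X 1 ^ (t + i)) = 1 := by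
  classical
  have hX : MvPowerSeries.C γ * MvPowerSeries.X (1 : Fin 2) =
      MvPowerSeries.monomial (Finsupp.single 1 1) γ := by
    rw [MvPowerSeries.X, ← MvPowerSeries.monomial_zero_eq_C_apply,
      MvPowerSeries.monomial_mul_monomial, zero_add, mul_one]
  have hS : ∀ i, MvPowerSeries.X (0 : Fin 2) *
      (MvPowerSeries.C (w i k) * MvPowerSeries.X 1 ^ (t + i)) =
      MvPowerSeries.monomial (Finsupp.single 0 1 + Finsupp.single 1 (t + i)) (w i k) := by
    intro i
    rw [MvPowerSeries.X_pow_eq, MvPowerSeries.X, ← MvPowerSeries.monomial_zero_eq_C_apply,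
      MvPowerSeries.monomial_mul_monomial, MvPowerSeries.monomial_mul_monomial, zero_add, mul_one,
      one_mul]
  rw [Finset.mul_sum, Finset.sum_congr rfl fun i _ => hS i, hX]
  ext m
  obtain ⟨n, hn⟩ : ∃ n, m 0 = n := ⟨_, rfl⟩
  obtain ⟨l, hl⟩ : ∃ l, m 1 = l := ⟨_, rfl⟩
  have hcoeff : ∀ m' : Fin 2 →₀ ℕ, MvPowerSeries.coeff m' (genFun (recMatrix t ℓ w fun _ => γ)) =
      recMatrix t ℓ w (fun _ => γ) (m' 0) (m' 1) := fun _ => rfl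
  have hle1 : Finsupp.single (1 : Fin 2) 1 ≤ m ↔ 1 ≤ l := by
    rw [Finsupp.single_le_iff, hl]
  have hle2 : ∀ i, Finsupp.single (0 : Fin 2) 1 + Finsupp.single 1 (t + i) ≤ m ↔
      1 ≤ n ∧ t + i ≤ l := by
    intro i
    rw [Finsupp.le_def, Fin.forall_fin_two]
    simp [hn, hl]
  have hm : m = 0 ↔ n = 0 ∧ l = 0 := by
    rw [DFunLike.ext_iff, Fin.forall_fin_two]
    simp [hn, hl]
  rw [mul_sub, mul_sub, mul_one, Finset.mul_sum, map_sub, map_sub, map_sum,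
    MvPowerSeries.coeff_mul_monomial, MvPowerSeries.coeff_one]
  simp only [MvPowerSeries.coeff_mul_monomial, hcoeff, hle1, hle2, hm, Finsupp.tsub_apply,
    Finsupp.add_apply, Finsupp.single_apply, hn, hl]
  have hsum : ∀ n, ∑ i ∈ range (ℓ + 1), (if 1 ≤ n + 1 ∧ t + i ≤ l then
      recMatrix t ℓ w (fun _ => γ) n (l - (t + i)) * w i k else 0) =
      rowTransfer t ℓ w (recMatrix t ℓ w (fun _ => γ) n) l := by
    intro n
    refine Finset.sum_congr rfl fun i hi => ?_
    rw [hw i (by simpa [Nat.lt_succ_iff] using hi) k l, mul_comm]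
    simp
  -- The coefficient of `q^n z^l` is the defect of the recurrence: `1` at the origin and `0`
  -- elsewhere.
  rcases n with _ | n <;> rcases l with _ | l
  · simp [recMatrix_zero_eq, resolventStep]
  · simp [recMatrix_zero_eq, resolventStep, mul_comm]
  · have := hsum n
    simp at this
    simp [this]
    simp [recMatrix_succ_eq, resolventStep]
  · have := hsum n
    simp at this
    simp [this]
    simp [recMatrix_succ_eq, resolventStep, mul_comm]

end Formulas

/-! ### Polynomials with nonnegative coefficients -/

section MvPolynomial

/-- The subsemiring of the real polynomials with nonnegative coefficients. -/
def coeffNonnegSubsemiring (τ : Type*) : Subsemiring (MvPolynomial τ ℝ) where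
  carrier := {p | CoeffNonneg p}
  zero_mem' m := by simp
  one_mem' m := by
    classical
    rw [MvPolynomial.coeff_one]
    split_ifs <;> norm_num
  add_mem' hp hq m := by
    rw [MvPolynomial.coeff_add]
    exact add_nonneg (hp m) (hq m)
  mul_mem' hp hq m := by
    classical
    rw [MvPolynomial.coeff_mul]
    exact Finset.sum_nonneg fun x _ => mul_nonneg (hp _) (hq _)

theorem CoeffNonneg.rename {τ υ : Type*} {f : τ → υ} (hf : Function.Injective f)
    {p : MvPolynomial τ ℝ} (hp : CoeffNonneg p) : CoeffNonneg (MvPolynomial.rename f p) := by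
  intro m
  by_cases h : ∃ u : τ →₀ ℕ, u.mapDomain f = m
  · obtain ⟨u, rfl⟩ := h
    rw [MvPolynomial.coeff_rename_mapDomain f hf]
    exact hp u
  · rw [MvPolynomial.coeff_rename_eq_zero]
    intro u hu
    exact absurd ⟨u, hu⟩ h

theorem coeffNonneg_X {τ : Type*} (i : τ) : CoeffNonneg (MvPolynomial.X i : MvPolynomial τ ℝ) := by
  classical
  intro m
  rw [MvPolynomial.coeff_X]
  split_ifs <;> norm_num

theorem totallyPositive_of_forall_minorsMem {τ : Type*} {A : Matrix ℕ ℕ (MvPolynomial τ ℝ)}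
    (h : ∀ r, MinorsMem (coeffNonnegSubsemiring τ) r A) : TotallyPositive A :=
  fun m f g hf hg => h m m le_rfl f g hf hg

/-- Renaming is a ring homomorphism, so it commutes with minors; injectivity prevents coefficients
from merging. -/
theorem minorsMem_bandMatrix_rename {τ υ : Type*} {f : τ → υ} (hf : Function.Injective f)
    {r ℓ : ℕ} {a : ℕ → ℕ → MvPolynomial τ ℝ} (ha : TotallyPositiveOfOrder r (bandMatrix ℓ a)) :
    MinorsMem (coeffNonnegSubsemiring υ) r
      (bandMatrix ℓ fun i k => MvPolynomial.rename f (a i k)) := by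
  intro m hm g h hg hh
  have h1 : (bandMatrix ℓ fun i k => MvPolynomial.rename f (a i k)).submatrix g h =
      (MvPolynomial.rename f).toRingHom.mapMatrix ((bandMatrix ℓ a).submatrix g h) := by
    ext1 i j
    simp only [Matrix.submatrix_apply, bandMatrix, RingHom.mapMatrix_apply, Matrix.map_apply]
    split_ifs
    · rfl
    · exact (map_zero _).symm
  rw [h1, ← RingHom.map_det]
  exact (ha m hm g h hg hh).rename hf

theorem minorsMem_transposeMatrix {I J : Type*} {r t ℓ : ℕ} {a : ℕ → ℕ → MvPolynomial I ℝ}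
    {b : ℕ → MvPolynomial J ℝ} (hb : ∀ k, CoeffNonneg (b k))
    (ha : TotallyPositiveOfOrder r (bandMatrix ℓ a)) :
    MinorsMem (coeffNonnegSubsemiring (I ⊕ J)) r (transposeMatrix t ℓ a b) :=
  minorsMem_recMatrix t ℓ _ _ (minorsMem_bandMatrix_rename Sum.inl_injective ha)
    fun k => (hb k).rename Sum.inr_injective

/-- If the band matrix factors into bidiagonal matrices with coefficientwise nonnegative entries,
then the recursive matrix and the Toeplitz matrices of its columns are totally positive. -/
theorem totallyPositive_of_bidiagonal_factorization {I J : Type*} {t ℓ : ℕ}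
    {a : ℕ → ℕ → MvPolynomial I ℝ} {b : ℕ → MvPolynomial J ℝ} (hb : ∀ k, CoeffNonneg (b k))
    {d c : ℕ → ℕ → MvPolynomial (I ⊕ J) ℝ}
    (h : ∀ v, rowTransfer 0 ℓ (fun i k => MvPolynomial.rename Sum.inl (a i k)) v =
      iterBidiagonal d c ℓ v)
    (hd : ∀ i < ℓ, ∀ k, CoeffNonneg (d i k)) (hc : ∀ i < ℓ, ∀ k, CoeffNonneg (c i k)) :
    TotallyPositive (transposeMatrix t ℓ a b) ∧
      (1 ≤ t → ∀ k : ℕ, TotallyPositive (toeplitz fun n => transposeMatrix t ℓ a b n k)) := by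
  have hb' : ∀ k, MvPolynomial.rename Sum.inr (b k) ∈ coeffNonnegSubsemiring (I ⊕ J) :=
    fun k => (hb k).rename Sum.inr_injective
  exact ⟨totallyPositive_of_forall_minorsMem fun r =>
      minorsMem_recMatrix t ℓ _ _ (minorsMem_bandMatrix h hd hc) hb',
    fun ht k => totallyPositive_of_forall_minorsMem fun r =>
      minorsMem_toeplitz_column ht h hd hc hb' k⟩

end MvPolynomial

end LatticeTP

/-! ### The main theorem -/

theorem theorem5p5 {I J : Type*} (t ℓ : ℕ)
    (a : ℕ → ℕ → MvPolynomial I ℝ)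
    (ha : ∀ i k : ℕ, i ≤ ℓ → LatticeTP.CoeffNonneg (a i k))
    (b : ℕ → MvPolynomial J ℝ) (hb : ∀ k : ℕ, LatticeTP.CoeffNonneg (b k)) :
    -- general weights
    ((∀ r : ℕ, LatticeTP.TotallyPositiveOfOrder r (LatticeTP.bandMatrix ℓ a) →
        LatticeTP.TotallyPositiveOfOrder r (LatticeTP.transposeMatrix t ℓ a b)) ∧
      (LatticeTP.TotallyPositive (LatticeTP.bandMatrix ℓ a) →
        LatticeTP.TotallyPositive (LatticeTP.transposeMatrix t ℓ a b))) ∧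
    -- the bidiagonal case
    (ℓ = 1 →
      LatticeTP.TotallyPositive (LatticeTP.transposeMatrix t ℓ a b) ∧
      (1 ≤ t → ∀ k : ℕ, LatticeTP.TotallyPositive
        (LatticeTP.toeplitz fun n => LatticeTP.transposeMatrix t ℓ a b n k))) ∧
    -- the tridiagonal case
    (ℓ = 2 → ∀ α β lam mu : ℕ → MvPolynomial I ℝ,
      (∀ k, LatticeTP.CoeffNonneg (α k)) → (∀ k, LatticeTP.CoeffNonneg (β k)) →
      (∀ k, LatticeTP.CoeffNonneg (lam k)) → (∀ k, LatticeTP.CoeffNonneg (mu k)) →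
      (∀ k, a 0 k = α k * lam k) →
      (∀ k, 1 ≤ k → a 1 k = α k * mu k + β k * lam (k - 1)) →
      (∀ k, 2 ≤ k → a 2 k = β k * mu (k - 1)) →
      LatticeTP.TotallyPositive (LatticeTP.transposeMatrix t ℓ a b) ∧
      (1 ≤ t → ∀ k : ℕ, LatticeTP.TotallyPositive
        (LatticeTP.toeplitz fun n => LatticeTP.transposeMatrix t ℓ a b n k))) ∧
    -- weights that factor into linear terms; the indeterminates are `α_j = X (Sum.inl j)`
    -- and `β_j = X (Sum.inr j)`, and `w i k` is `a_k^{(i)}`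
    (∀ w : ℕ → ℕ → MvPolynomial (Fin ℓ ⊕ Fin ℓ) ℝ,
      (∀ k : ℕ,
        ∑ i ∈ Finset.range (ℓ + 1), Polynomial.C (w i k) * (Polynomial.X : Polynomial _) ^ i =
          ∏ j : Fin ℓ, (Polynomial.C (MvPolynomial.X (Sum.inl j)) * Polynomial.X +
            Polynomial.C (MvPolynomial.X (Sum.inr j)))) →
      -- (i)
      (LatticeTP.TotallyPositive (LatticeTP.transposeMatrix t ℓ w b) ∧
        (1 ≤ t → ∀ k : ℕ, LatticeTP.TotallyPositive
          (LatticeTP.toeplitz fun n => LatticeTP.transposeMatrix t ℓ w b n k))) ∧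
      (∀ γ : MvPolynomial J ℝ, (∀ k : ℕ, b k = γ) →
        -- (ii)
        (∀ n : ℕ, LatticeTP.TotallyPositive
          (LatticeTP.toeplitz fun k => LatticeTP.transposeMatrix t ℓ w b n k)) ∧
        -- (iii)
        (1 ≤ t → ∀ n k σ δ : ℕ, n ≤ k → 0 < δ → max n δ < σ →
          LatticeTP.TotallyPositive
            (LatticeTP.toeplitz fun i =>
              LatticeTP.transposeMatrix t ℓ w b (n + σ * i) (k + δ * i))) ∧
        -- (iv)
        (∀ n k : ℕ,
          LatticeTP.transposeMatrix t ℓ w b n k =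
            ∑ p ∈ (Finset.range (k + 1) ×ˢ
                Fintype.piFinset fun _ : Fin ℓ => Finset.range (n + 1)).filter
                (fun p : ℕ × (Fin ℓ → ℕ) => (p.1 : ℤ) + ∑ j, (p.2 j : ℤ) = (k : ℤ) - t * n),
              ((n + p.1).choose p.1 : MvPolynomial ((Fin ℓ ⊕ Fin ℓ) ⊕ J) ℝ) *
                MvPolynomial.rename Sum.inr γ ^ p.1 *
                ∏ j : Fin ℓ, ((n.choose (p.2 j) : MvPolynomial ((Fin ℓ ⊕ Fin ℓ) ⊕ J) ℝ) *
                  MvPolynomial.X (Sum.inl (Sum.inl j)) ^ p.2 j *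
                  MvPolynomial.X (Sum.inl (Sum.inr j)) ^ (n - p.2 j))) ∧
        -- (v)
        (∀ k : ℕ,
          LatticeTP.genFun (LatticeTP.transposeMatrix t ℓ w b) *
            (1 - MvPowerSeries.C (MvPolynomial.rename Sum.inr γ) * MvPowerSeries.X 1 -
              MvPowerSeries.X 0 * ∑ i ∈ Finset.range (ℓ + 1),
                MvPowerSeries.C (MvPolynomial.rename Sum.inl (w i k)) *
                  MvPowerSeries.X 1 ^ (t + i)) = 1))) := by
  have inl_nn : ∀ {I J : Type _} {p : MvPolynomial I ℝ}, LatticeTP.CoeffNonneg p →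
      LatticeTP.CoeffNonneg (MvPolynomial.rename (Sum.inl : I → I ⊕ J) p) :=
    fun hp => hp.rename Sum.inl_injective
  refine ⟨⟨fun r hA => LatticeTP.minorsMem_transposeMatrix hb hA, fun hA =>
    LatticeTP.totallyPositive_of_forall_minorsMem fun r =>
      LatticeTP.minorsMem_transposeMatrix hb fun m _ => hA m⟩, ?_, ?_, ?_⟩
  · rintro rfl
    refine LatticeTP.totallyPositive_of_bidiagonal_factorization hb
      (LatticeTP.rowTransfer_one _) ?_ ?_
    · exact fun _ _ k => inl_nn (ha 0 k (by omega))
    · exact fun _ _ k => inl_nn (ha 1 k le_rfl)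
  · rintro rfl α β lam mu hα hβ hlam hmu h0 h1 h2
    refine LatticeTP.totallyPositive_of_bidiagonal_factorization hb
      (LatticeTP.rowTransfer_two (α := fun k => MvPolynomial.rename Sum.inl (α k))
        (β := fun k => MvPolynomial.rename Sum.inl (β k))
        (lam := fun k => MvPolynomial.rename Sum.inl (lam k))
        (mu := fun k => MvPolynomial.rename Sum.inl (mu k)) (fun k => ?_) (fun k hk => ?_)
        (fun k hk => ?_)) ?_ ?_
    · rw [h0, map_mul]
    · rw [h1 k hk, map_add, map_mul, map_mul]
    · rw [h2 k hk, map_mul]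
    · intro i _ k
      split_ifs
      exacts [inl_nn (hlam k), inl_nn (hα k)]
    · intro i _ k
      split_ifs
      exacts [inl_nn (hmu k), inl_nn (hβ k)]
  · intro w hw
    -- The indeterminates are extended by `0` to all of `ℕ`, since the layers are indexed by natural
    -- numbers.
    let A : ℕ → MvPolynomial ((Fin ℓ ⊕ Fin ℓ) ⊕ J) ℝ := fun j =>
      if h : j < ℓ then MvPolynomial.X (Sum.inl (Sum.inl ⟨j, h⟩)) else 0
    let B : ℕ → MvPolynomial ((Fin ℓ ⊕ Fin ℓ) ⊕ J) ℝ := fun j =>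
      if h : j < ℓ then MvPolynomial.X (Sum.inl (Sum.inr ⟨j, h⟩)) else 0
    let W : ℕ → ℕ → MvPolynomial ((Fin ℓ ⊕ Fin ℓ) ⊕ J) ℝ := fun i k =>
      MvPolynomial.rename Sum.inl (w i k)
    have hA : ∀ j, LatticeTP.CoeffNonneg (A j) := fun j => by
      simp only [A]
      split_ifs
      exacts [LatticeTP.coeffNonneg_X _, (LatticeTP.coeffNonnegSubsemiring _).zero_mem]
    have hB : ∀ j, LatticeTP.CoeffNonneg (B j) := fun j => by
      simp only [B]
      split_ifs
      exacts [LatticeTP.coeffNonneg_X _, (LatticeTP.coeffNonnegSubsemiring _).zero_mem]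
    have hAj : ∀ j : Fin ℓ, A j = MvPolynomial.X (Sum.inl (Sum.inl j)) := fun j => by simp [A]
    have hBj : ∀ j : Fin ℓ, B j = MvPolynomial.X (Sum.inl (Sum.inr j)) := fun j => by simp [B]
    have hW : ∀ k, ∑ i ∈ Finset.range (ℓ + 1),
        Polynomial.C (W i k) * (Polynomial.X : Polynomial _) ^ i =
          ∏ j ∈ Finset.range ℓ, (Polynomial.C (A j) * Polynomial.X + Polynomial.C (B j)) := by
      intro k
      have := congrArg (Polynomial.mapRingHom (MvPolynomial.rename (R := ℝ)
        (Sum.inl : Fin ℓ ⊕ Fin ℓ → (Fin ℓ ⊕ Fin ℓ) ⊕ J)).toRingHom) (hw k)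
      rw [Finset.prod_range]
      simpa [map_sum, map_prod, hAj, hBj] using this
    have hconst := LatticeTP.weight_eq_of_factorization hW
    have hF := LatticeTP.weightSeries_eq_prod hW
    refine ⟨LatticeTP.totallyPositive_of_bidiagonal_factorization hb
      (LatticeTP.rowTransfer_of_factorization hW) (fun _ _ _ => hB _) (fun _ _ _ => hA _), ?_⟩
    intro γ hγ
    have hγN : MvPolynomial.rename Sum.inr γ ∈
        LatticeTP.coeffNonnegSubsemiring ((Fin ℓ ⊕ Fin ℓ) ⊕ J) :=
      (hγ 0 ▸ hb 0).rename Sum.inr_injective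
    have hT : LatticeTP.transposeMatrix t ℓ w b =
        LatticeTP.recMatrix t ℓ W fun _ => MvPolynomial.rename Sum.inr γ := by
      rw [LatticeTP.transposeMatrix]
      simp only [hγ]
      rfl
    rw [hT]
    refine ⟨fun n => ?_, fun ht n k σ δ _ _ hσ => ?_, fun n k => ?_, fun k => ?_⟩
    · exact LatticeTP.totallyPositive_of_forall_minorsMem fun r =>
        LatticeTP.minorsMem_toeplitz_row hconst hF hA hB t hγN n
    · exact LatticeTP.totallyPositive_of_forall_minorsMem fun r =>
        -- The slant condition comes from `δ < σ ≤ t * σ`, using `1 ≤ t`.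
        LatticeTP.minorsMem_toeplitz_slanted hconst hF hA hB hγN (by omega)
          (lt_of_lt_of_le (lt_of_le_of_lt (le_max_right n δ) hσ) (Nat.le_mul_of_pos_left σ ht))
    · refine LatticeTP.recMatrix_eq_sum_of_series ?_ k
      rw [LatticeTP.mk_recMatrix hconst hF, Finset.prod_range]
      simp only [hAj, hBj]
    · exact LatticeTP.genFun_recMatrix_mul
        (fun i hi k k' => (hconst i hi k).trans (hconst i hi k').symm) t _ k
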